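/- A graph (finite, undirected, simple) is a cluster graph if each of its connected components is a clique. A block of a graph is a maximal connected subgraph that has no cut vertex of its own, and a graph is a block graph if each of its blocks is a clique. **Theorem.** The vertex deletion problem from block graphs to cluster graphs is in P: there is a Turing machine that, given (the adjacency matrix of) any block graph $G$, outputs, in time polynomial in the size of the input, a set $V_-\subseteq V(G)$ of minimum cardinality such that $G-V_-$ is a cluster graph. -/

import Mathlib

namespace VertexDeletion

/-- A class of (undirected, simple) graphs. -/
abbrev GraphClass := (V : Type) → SimpleGraph V → Prop

/-- A cluster graph: every connected component is a clique. -/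
def IsClusterGraph {V : Type*} (G : SimpleGraph V) : Prop :=
  ∀ c : G.ConnectedComponent, G.IsClique c.supp

/-- `v` is a cut vertex of `G`: it separates two other vertices of the same component of `G`. -/
def IsCutVertex {V : Type*} (G : SimpleGraph V) (v : V) : Prop :=
  ∃ (a b : V) (ha : a ∈ ({v}ᶜ : Set V)) (hb : b ∈ ({v}ᶜ : Set V)),
    G.Reachable a b ∧ ¬ (G.induce ({v}ᶜ : Set V)).Reachable ⟨a, ha⟩ ⟨b, hb⟩

/-- `U` induces a nonempty connected subgraph of `G` that has no cut vertex of its own. -/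
def IsBiconnectedSet {V : Type*} (G : SimpleGraph V) (U : Set V) : Prop :=
  (G.induce U).Connected ∧ ∀ v : U, ¬ IsCutVertex (G.induce U) v

/-- A block (biconnected component) of `G`: a maximal biconnected subgraph, given by its vertex
set. (Adding edges preserves biconnectedness, so maximal biconnected subgraphs are induced.) -/
def IsBlock {V : Type*} (G : SimpleGraph V) (U : Set V) : Prop :=
  Maximal (IsBiconnectedSet G) U

/-- A block graph: every block is a clique. -/
def IsBlockGraph {V : Type*} (G : SimpleGraph V) : Prop :=
  ∀ U : Set V, IsBlock G U → G.IsClique U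

/-- The class of cluster graphs. -/
def cluster : GraphClass := fun _ G => IsClusterGraph G

/-- The class of block graphs. -/
def block : GraphClass := fun _ G => IsBlockGraph G

/-- `S` is a minimum set of vertices whose deletion from `G` leaves a graph of the class `C`. -/
def IsMinimumDeletionSet (C : GraphClass) {V : Type} (G : SimpleGraph V) (S : Finset V) : Prop :=
  C _ (G.induce ((S : Set V)ᶜ)) ∧
    ∀ T : Finset V, C _ (G.induce ((T : Set V)ᶜ)) → S.card ≤ T.card

/-- An input: a graph of the class `C` on the vertex set `{0, …, order - 1}`. -/
structure Input (C : GraphClass) where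
  order : ℕ
  graph : SimpleGraph (Fin order)
  mem : C _ graph

open Classical in
/-- The input word: the rows of the 0-1 adjacency matrix, one after the other, each followed by
the end marker `none`. A graph on `n` vertices gives a word of length `n * (n + 1)`. -/
noncomputable def encodeGraph {n : ℕ} (G : SimpleGraph (Fin n)) : List (Option Bool) :=
  (List.finRange n).flatMap fun i =>
    (List.finRange n).map (fun j => some (decide (G.Adj i j))) ++ [none]

/-- The output word: the characteristic vector of a set of vertices. -/
def encodeSet {n : ℕ} (S : Finset (Fin n)) : List Bool :=
  (List.finRange n).map fun i => decide (i ∈ S)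

/-- The vertex deletion problem from `C₁` to `C₂` is in P: some Turing machine, in time polynomial
in the length of its input word, outputs for every graph `G` in `C₁` a minimum vertex set whose
deletion from `G` leaves a graph in `C₂`. -/
def InP (C₁ C₂ : GraphClass) : Prop :=
  ∃ S : (I : Input C₁) → Finset (Fin I.order),
    (∀ I, IsMinimumDeletionSet C₂ I.graph (S I)) ∧
      Nonempty (Turing.TM2ComputableInPolyTime
        (fun I : Input C₁ => encodeGraph I.graph) (id : List Bool → List Bool)
        (fun I : Input C₁ => encodeSet (S I)))

end VertexDeletion

/-! A graph is a cluster graph exactly when it has no induced path on three vertices, so a minimum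
deletion set is a minimum set hitting all these paths. Call `v` safe if every hitting set can be
exchanged, without growing, for one that contains `v`. Choosing safe vertices one after another is
then an optimal greedy strategy (`IsExtendable.insert`).

Block graphs enter through one property (`IsBlockGraph.hasCliqueBranches`): two neighbours of `w`
joined by a path that avoids `w` lie with `w` on a cycle, hence in a common block, hence are
adjacent. The property survives when the chosen vertices are isolated, which stands for deleting
them without changing the vertex type.

While an induced path survives, one of three local rules selects a vertex, and each rule is safe by
an exchange argument. To find the vertex (`exists_ruleApplies_of_minimal_branch`), take an
inclusion-minimal component of some `G - w`, reached through a neighbour of `w`, that does not form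
a clique together with `w`. The neighbours of `w` in it form a clique `Q`, and by minimality only
pendant cliques hang from the vertices of `Q`. A vertex of `Q` with two of them falls under the
first rule. If some vertex of `Q` has none, a vertex of `Q` with one falls under the second. If
every vertex of `Q` has exactly one, the third rule selects `w`. If no such component exists, the
first rule selects the centre of any induced path.

The rules are first-order conditions on adjacency and the chosen set, so trying all values of a
fixed number of variables decides them in polynomial time (`Query.does_program`), and `n` passes
over the `n` vertices suffice (`hitsP3_greedySet`). The machine is a structured stack program whose
steps translate one for one into steps of a `TM2` machine (`Prog.Exec.iterate_step`);
`Program.runs_main` bounds its running time. -/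

namespace VertexDeletion

/-! ### Induced paths on three vertices, and safe reduction rules -/

section Graph

variable {V : Type*} {G : SimpleGraph V}

/-- `x, y, z` is an induced path on three vertices with middle vertex `y`. -/
def IsInducedP3 (G : SimpleGraph V) (x y z : V) : Prop :=
  G.Adj x y ∧ G.Adj y z ∧ x ≠ z ∧ ¬ G.Adj x z

/-- `T` meets every induced path on three vertices. -/
def HitsP3 (G : SimpleGraph V) (T : Finset V) : Prop :=
  ∀ x y z, IsInducedP3 G x y z → x ∈ T ∨ y ∈ T ∨ z ∈ T

/-- Every induced path on three vertices that contains `a` contains `v`. -/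
def P3Dominated (G : SimpleGraph V) (a v : V) : Prop :=
  ∀ x y z, IsInducedP3 G x y z → (x = a ∨ y = a ∨ z = a) → (x = v ∨ y = v ∨ z = v)

/-- Along a walk from `x`, the first vertex that is neither `x` nor adjacent to `x` would end an
induced path starting at `x`. -/
theorem isClusterGraph_iff_forall_not_isInducedP3 :
    IsClusterGraph G ↔ ∀ x y z, ¬ IsInducedP3 G x y z := by
  constructor
  · rintro h x y z ⟨hxy, hyz, hne, hn⟩
    refine hn (h (G.connectedComponentMk x) ?_ ?_ hne)
    · rfl
    · exact SimpleGraph.ConnectedComponent.sound (hxy.reachable.trans hyz.reachable).symm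
  · intro h c x hx y hy hne
    have hr : G.Reachable x y := SimpleGraph.ConnectedComponent.exact (hx.trans hy.symm)
    rw [SimpleGraph.reachable_iff_reflTransGen] at hr
    have : x = y ∨ G.Adj x y := by
      clear hy hne
      induction hr with
      | refl => exact .inl rfl
      | @tail b c _ hbc ih =>
        by_contra! hcon
        rcases ih with rfl | ih
        · exact hcon.2 hbc
        · exact h x b c ⟨ih, hbc, hcon.1, hcon.2⟩
    exact this.resolve_left hne

theorem isClusterGraph_induce_compl_iff (T : Finset V) :
    IsClusterGraph (G.induce ((T : Set V)ᶜ)) ↔ HitsP3 G T := by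
  rw [isClusterGraph_iff_forall_not_isInducedP3]
  constructor
  · intro h x y z hp
    by_contra! hcon
    refine h ⟨x, by simpa using hcon.1⟩ ⟨y, by simpa using hcon.2.1⟩ ⟨z, by simpa using hcon.2.2⟩ ?_
    obtain ⟨h1, h2, h3, h4⟩ := hp
    exact ⟨h1, h2, by simpa [Subtype.ext_iff] using h3, h4⟩
  · rintro h ⟨x, hx⟩ ⟨y, hy⟩ ⟨z, hz⟩ ⟨h1, h2, h3, h4⟩
    have := h x y z ⟨h1, h2, by simpa [Subtype.ext_iff] using h3, h4⟩
    simp at hx hy hz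
    tauto

/-- Every hitting set can be replaced by one of at most the same size that contains `v`. -/
def IsSafe (G : SimpleGraph V) (v : V) : Prop :=
  ∀ T : Finset V, HitsP3 G T → ∃ T' : Finset V, HitsP3 G T' ∧ v ∈ T' ∧ T'.card ≤ T.card

section Exchange

variable [DecidableEq V]

theorem card_insert_erase_le {T : Finset V} {a : V} (v : V) (ha : a ∈ T) :
    (insert v (T.erase a)).card ≤ T.card := by
  have h1 := Finset.card_insert_le v (T.erase a)
  have h2 := Finset.card_erase_add_one ha
  omega

/-- Only paths through the removed vertex `a` can lose their hit, so only these need checking. -/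
theorem HitsP3.exchange {T : Finset V} {a v : V} (hT : HitsP3 G T)
    (h : ∀ x y z, IsInducedP3 G x y z → (x = a ∨ y = a ∨ z = a) →
      x ∈ insert v (T.erase a) ∨ y ∈ insert v (T.erase a) ∨ z ∈ insert v (T.erase a)) :
    HitsP3 G (insert v (T.erase a)) := by
  intro x y z hp
  by_cases ha : x = a ∨ y = a ∨ z = a
  · exact h x y z hp ha
  · have := hT x y z hp
    simp only [Finset.mem_insert, Finset.mem_erase]
    tauto

theorem HitsP3.exchange_of_dominated {T : Finset V} {a v : V} (hT : HitsP3 G T)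
    (h : P3Dominated G a v) : HitsP3 G (insert v (T.erase a)) := by
  refine hT.exchange fun x y z hp ha => ?_
  have := h x y z hp ha
  simp only [Finset.mem_insert]
  tauto

end Exchange

/-- First rule: `v` is the middle of an induced path whose ends are dominated by `v`. -/
def DominatedEndsRule (G : SimpleGraph V) (v : V) : Prop :=
  ∃ a b, IsInducedP3 G a v b ∧ P3Dominated G a v ∧ P3Dominated G b v

/-- Second rule: `v` dominates a neighbour `a`, and the block of another neighbour `u` lies
in the neighbourhood of `v` and is separated from `a` by `v`. -/
def PrivateNeighborRule (G : SimpleGraph V) (v : V) : Prop :=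
  ∃ a u, G.Adj v a ∧ P3Dominated G a v ∧ G.Adj v u ∧
    ∀ x, (x = u ∨ G.Adj u x) → x ≠ v → G.Adj v x ∧ ¬ G.Adj a x ∧ x ≠ a

/-- Third rule: in a block that contains `v`, every vertex other than `v` has a
pendant clique. -/
def PendantBlockRule (G : SimpleGraph V) (v : V) : Prop :=
  ∃ u₀, G.Adj v u₀ ∧
    (∀ u, G.Adj v u → (u = u₀ ∨ G.Adj u₀ u) → ∃ a, IsInducedP3 G v u a ∧ P3Dominated G a u) ∧
    ∀ x y z, IsInducedP3 G x y z → (x = u₀ ∨ y = u₀ ∨ z = u₀) →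
      (x = v ∨ G.Adj v x ∧ G.Adj u₀ x) ∨ (y = v ∨ G.Adj v y ∧ G.Adj u₀ y) ∨
        (z = v ∨ G.Adj v z ∧ G.Adj u₀ z)

/-- One of the three reduction rules selects `v`. -/
def RuleApplies (G : SimpleGraph V) (v : V) : Prop :=
  DominatedEndsRule G v ∨ PrivateNeighborRule G v ∨ PendantBlockRule G v

theorem DominatedEndsRule.isSafe {v : V} (h : DominatedEndsRule G v) : IsSafe G v := by
  classical
  obtain ⟨a, b, hp, ha, hb⟩ := h
  intro T hT
  by_cases hv : v ∈ T
  · exact ⟨T, hT, hv, le_rfl⟩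
  rcases hT a v b hp with h | h | h
  · exact ⟨_, hT.exchange_of_dominated ha, by simp, card_insert_erase_le v h⟩
  · exact absurd h hv
  · exact ⟨_, hT.exchange_of_dominated hb, by simp, card_insert_erase_le v h⟩

/-- If `T` contains `a`, exchange `a` for `v`. If it contains neither `a` nor `v`, the induced paths
`a, v, x` force into `T` the vertex `u` and all its neighbours other than `v`. Then `u` can be
exchanged for `v`, because a path through `u` also contains a neighbour of `u`. -/
theorem PrivateNeighborRule.isSafe {v : V} (h : PrivateNeighborRule G v) : IsSafe G v := by
  classical
  obtain ⟨a, u, hva, ha, hvu, hN⟩ := h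
  intro T hT
  by_cases hv : v ∈ T
  · exact ⟨T, hT, hv, le_rfl⟩
  by_cases haT : a ∈ T
  · exact ⟨_, hT.exchange_of_dominated ha, by simp, card_insert_erase_le v haT⟩
  have hin : ∀ x, (x = u ∨ G.Adj u x) → x ≠ v → x ∈ T := by
    intro x hx hxv
    obtain ⟨h1, h2, h3⟩ := hN x hx hxv
    have := hT a v x ⟨hva.symm, h1, h3.symm, h2⟩
    tauto
  have huT : u ∈ T := hin u (.inl rfl) hvu.ne'
  have hnb : ∀ x, G.Adj u x → x ∈ insert v (T.erase u) := by
    intro x hx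
    by_cases hxv : x = v
    · simp [hxv]
    · simp [hin x (.inr hx) hxv, hx.ne']
  refine ⟨_, hT.exchange (v := v) (a := u) ?_, by simp, card_insert_erase_le v huT⟩
  rintro x y z ⟨h1, h2, -, -⟩ (rfl | rfl | rfl)
  · exact .inr (.inl (hnb _ h1))
  · exact .inl (hnb _ h1.symm)
  · exact .inr (.inl (hnb _ h2.symm))

/-- If `T` misses `v` and a block vertex `u`, the path `v, u, a` forces the pendant vertex `a` into
`T`, and `a` can be exchanged for `u`. Repeating this brings the whole block except `v` into `T`.
Then `u₀` can be exchanged for `v`, since every path through `u₀` meets the rest of the block. -/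
theorem PendantBlockRule.isSafe [Finite V] {v : V} (h : PendantBlockRule G v) : IsSafe G v := by
  classical
  have := Fintype.ofFinite V
  obtain ⟨u₀, hvu, hQ, hP⟩ := h
  -- The induction is on a bound for the number of block vertices, other than `v`, that are missing
  -- from `T`.
  have key : ∀ (k : ℕ) (T : Finset V), HitsP3 G T →
      (Finset.univ.filter fun u => u ∉ T ∧ G.Adj v u ∧ (u = u₀ ∨ G.Adj u₀ u)).card ≤ k →
      ∃ T' : Finset V, HitsP3 G T' ∧ v ∈ T' ∧ T'.card ≤ T.card := by
    intro k
    induction k with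
    | zero =>
      intro T hT hk
      have hin : ∀ u, G.Adj v u → (u = u₀ ∨ G.Adj u₀ u) → u ∈ T := by
        intro u h1 h2
        by_contra h3
        have : u ∈ (Finset.univ.filter fun u => u ∉ T ∧ G.Adj v u ∧ (u = u₀ ∨ G.Adj u₀ u)) := by
          simp [h1, h2, h3]
        rw [Nat.le_zero, Finset.card_eq_zero] at hk
        simp [hk] at this
      refine ⟨_, hT.exchange (v := v) (a := u₀) ?_, by simp,
        card_insert_erase_le v (hin u₀ hvu (.inl rfl))⟩
      have hmem : ∀ x, (x = v ∨ G.Adj v x ∧ G.Adj u₀ x) → x ∈ insert v (T.erase u₀) := by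
        rintro x (rfl | ⟨h1, h2⟩)
        · simp
        · simp [h2.ne', hin x h1 (.inr h2)]
      intro x y z hp h
      exact (hP x y z hp h).imp (hmem x) (Or.imp (hmem y) (hmem z))
    | succ k ih =>
      intro T hT hk
      by_cases hv : v ∈ T
      · exact ⟨T, hT, hv, le_rfl⟩
      by_cases hall : ∃ u, u ∉ T ∧ G.Adj v u ∧ (u = u₀ ∨ G.Adj u₀ u)
      · obtain ⟨u, huT, h1, h2⟩ := hall
        obtain ⟨a, hp, ha⟩ := hQ u h1 h2
        have haT : a ∈ T := by
          have := hT v u a hp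
          tauto
        obtain ⟨T', h3, h4, h5⟩ := ih (insert u (T.erase a)) (hT.exchange_of_dominated ha) (by
          refine Nat.le_of_lt_succ (lt_of_lt_of_le (Finset.card_lt_card ?_) hk)
          rw [Finset.ssubset_iff_of_subset]
          · exact ⟨u, by simp [huT, h1, h2], by simp⟩
          · intro x
            simp only [Finset.mem_insert, Finset.mem_erase, Finset.mem_filter, Finset.mem_univ,
              true_and]
            rintro ⟨hx1, hx2, hx3⟩
            refine ⟨fun hxT => hx1 (.inr ⟨?_, hxT⟩), hx2, hx3⟩
            rintro rfl
            -- The removed vertex `a` is not adjacent to `v`, so the exchange takes no block vertex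
            -- out of `T`.
            exact hp.2.2.2 hx2)
        exact ⟨T', h3, h4, h5.trans (card_insert_erase_le u haT)⟩
      · refine ih T hT ?_
        rw [Finset.filter_false_of_mem]
        · simp
        · intro u _ hu
          exact hall ⟨u, hu⟩
  intro T hT
  exact key _ T hT le_rfl

theorem RuleApplies.isSafe [Finite V] {v : V} (h : RuleApplies G v) : IsSafe G v :=
  h.elim DominatedEndsRule.isSafe fun h => h.elim PrivateNeighborRule.isSafe
    PendantBlockRule.isSafe

/-! ### Branches at a vertex, and the existence of an applicable rule -/

/-- `x` and `y` are joined by a walk of `G` that avoids `w`. -/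
def ConnectedAvoiding (G : SimpleGraph V) (w : V) : V → V → Prop :=
  Relation.ReflTransGen fun x y => G.Adj x y ∧ x ≠ w ∧ y ≠ w

/-- Two neighbours of a vertex that are joined by a walk avoiding this vertex are adjacent. -/
def HasCliqueBranches (G : SimpleGraph V) : Prop :=
  ∀ w a b, G.Adj w a → G.Adj w b → a ≠ b → ConnectedAvoiding G w a b → G.Adj a b

theorem ConnectedAvoiding.symm {w a b : V} (h : ConnectedAvoiding G w a b) :
    ConnectedAvoiding G w b a := by
  induction h with
  | refl => exact .refl
  | tail _ h ih => exact Relation.ReflTransGen.head ⟨h.1.symm, h.2.2, h.2.1⟩ ih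

theorem ConnectedAvoiding.ne {w a b : V} (h : ConnectedAvoiding G w a b) (ha : a ≠ w) :
    b ≠ w := by
  induction h with
  | refl => exact ha
  | tail _ h _ => exact h.2.2

theorem ConnectedAvoiding.tail {w a b c : V} (h : ConnectedAvoiding G w a b) (ha : a ≠ w)
    (hbc : G.Adj b c) (hc : c ≠ w) : ConnectedAvoiding G w a c :=
  Relation.ReflTransGen.tail h ⟨hbc, h.ne ha, hc⟩

/-- The branch of `G` at `w` through `c`: the component of `c` in `G - w`, together with `w`, is
a clique. -/
def IsCliqueBranch (G : SimpleGraph V) (w c : V) : Prop :=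
  G.IsClique (insert w {x | ConnectedAvoiding G w c x})

/-- A path through `c` that avoids `w` stays in the component of `c` in `G - w`, where its ends
would be adjacent. -/
theorem IsCliqueBranch.dominated {w c : V} (h : IsCliqueBranch G w c) (hc : c ≠ w) :
    P3Dominated G c w := by
  rintro x y z ⟨hxy, hyz, hne, hn⟩ hmem
  by_contra! hw
  obtain ⟨h1, h2, h3⟩ := hw
  have hy : ConnectedAvoiding G w c y := by
    rcases hmem with rfl | rfl | rfl
    · exact ConnectedAvoiding.tail .refl hc hxy h2
    · exact .refl
    · exact ConnectedAvoiding.tail .refl hc hyz.symm h2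
  exact hn (h (.inr (hy.tail hc hxy.symm h1)) (.inr (hy.tail hc hyz h3)) hne)

theorem dominatedEndsRule_of_forall_isCliqueBranch
    (h : ∀ w c, G.Adj w c → IsCliqueBranch G w c) {x y z : V} (hp : IsInducedP3 G x y z) :
    DominatedEndsRule G y :=
  ⟨x, z, hp, (h y x hp.1.symm).dominated hp.1.ne, (h y z hp.2.1).dominated hp.2.1.ne'⟩

/-- The case distinction counts the pendant cliques at the vertices of the clique `Q` of neighbours
of `w` in the branch: two at some vertex (`hone`), none at some vertex (`hfree`), or exactly one
everywhere. The rules apply in this order. -/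
theorem exists_ruleApplies_of_minimal_branch (hG : HasCliqueBranches G) {w c : V}
    (hwc : G.Adj w c) (hbad : ¬ IsCliqueBranch G w c)
    (hmin : ∀ u a, G.Adj u a →
      {x | ConnectedAvoiding G u a x} ⊂ {x | ConnectedAvoiding G w c x} → IsCliqueBranch G u a) :
    ∃ v, RuleApplies G v := by
  have hcw : c ≠ w := hwc.ne'
  have hQ : ∀ u v, G.Adj w u → ConnectedAvoiding G w c u → G.Adj w v →
      ConnectedAvoiding G w c v → u ≠ v → G.Adj u v :=
    fun u v h1 h2 h3 h4 hne => hG w u v h1 h3 hne (h2.symm.trans h4)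
  -- The vertex `u` separates `w` from its outer neighbours: otherwise `a` and `w`, both neighbours
  -- of `u`, would be adjacent.
  have hsep : ∀ u a, G.Adj w u → G.Adj u a → ¬ G.Adj w a → a ≠ w →
      ¬ ConnectedAvoiding G u a w :=
    fun u a h1 h2 h3 h4 h5 => h3 (hG u a w h2 h1.symm h4 h5).symm
  have hpend : ∀ u a, G.Adj w u → ConnectedAvoiding G w c u → G.Adj u a → ¬ G.Adj w a → a ≠ w →
      IsCliqueBranch G u a := by
    intro u a h1 h2 h3 h4 h5
    refine hmin u a h3 ?_
    have hsub : ∀ x, ConnectedAvoiding G u a x → ConnectedAvoiding G w c x := by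
      intro x hx
      have hxw : ∀ x, ConnectedAvoiding G u a x → x ≠ w := by
        rintro x hx rfl
        exact hsep u a h1 h3 h4 h5 hx
      induction hx with
      | refl => exact h2.tail hcw h3 h5
      | @tail b d hb hbd ih => exact ih.tail hcw hbd.1 (hxw d (hb.tail hbd))
    -- The inclusion is strict because `u` belongs to the large branch but not to `G - u`.
    refine ⟨hsub, fun hcon => ?_⟩
    exact ConnectedAvoiding.ne (hcon (show u ∈ {x | ConnectedAvoiding G w c x} from h2)) h3.ne' rfl
  -- Without outer neighbours the branch would consist of `Q` alone and would be a clique with `w`.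
  have hex : ∃ u a, G.Adj w u ∧ ConnectedAvoiding G w c u ∧ G.Adj u a ∧ ¬ G.Adj w a ∧ a ≠ w := by
    by_contra! hcon
    apply hbad
    have hall : ∀ x, ConnectedAvoiding G w c x → G.Adj w x := by
      intro x hx
      induction hx with
      | refl => exact hwc
      | @tail b d hb hbd ih =>
        by_contra hd
        exact hbd.2.2 (hcon b d ih hb hbd.1 hd)
    rintro x (rfl | hx) y (rfl | hy) hne
    · exact absurd rfl hne
    · exact hall y hy
    · exact (hall x hx).symm
    · exact hQ x y (hall x hx) hx (hall y hy) hy hne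
  by_cases hone : ∃ u a b, G.Adj w u ∧ ConnectedAvoiding G w c u ∧ G.Adj u a ∧ ¬ G.Adj w a ∧
      a ≠ w ∧ G.Adj u b ∧ ¬ G.Adj w b ∧ b ≠ w ∧ a ≠ b ∧ ¬ G.Adj a b
  · obtain ⟨u, a, b, h1, h2, h3, h4, h5, h6, h7, h8, h9, h10⟩ := hone
    exact ⟨u, .inl ⟨a, b, ⟨h3.symm, h6, h9, h10⟩, (hpend u a h1 h2 h3 h4 h5).dominated h3.ne',
      (hpend u b h1 h2 h6 h7 h8).dominated h6.ne'⟩⟩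
  push Not at hone
  by_cases hfree : ∃ u', G.Adj w u' ∧ ConnectedAvoiding G w c u' ∧
      ∀ a, G.Adj u' a → a ≠ w → G.Adj w a
  · obtain ⟨u', h1', h2', h3'⟩ := hfree
    obtain ⟨u, a, h1, h2, h3, h4, h5⟩ := hex
    have hne : u ≠ u' := by
      rintro rfl
      exact h4 (h3' a h3 h5)
    refine ⟨u, .inr (.inl ⟨a, u', h3, (hpend u a h1 h2 h3 h4 h5).dominated h3.ne',
      hQ u u' h1 h2 h1' h2' hne, ?_⟩)⟩
    intro x hx hxu
    by_cases hxw : x = w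
    · subst hxw
      exact ⟨h1.symm, fun h => h4 h.symm, h5.symm⟩
    have hwx : G.Adj w x := by
      rcases hx with rfl | hx
      · exact h1'
      · exact h3' x hx hxw
    have hcx : ConnectedAvoiding G w c x := by
      rcases hx with rfl | hx
      · exact h2'
      · exact h2'.tail hcw hx hxw
    refine ⟨hQ u x h1 h2 hwx hcx hxu.symm, fun hax => hsep u a h1 h3 h4 h5 ?_, ?_⟩
    · exact (ConnectedAvoiding.tail .refl h3.ne' hax hxu).tail h3.ne' hwx.symm h1.ne
    · rintro rfl
      exact h4 hwx
  · push Not at hfree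
    refine ⟨w, .inr (.inr ⟨c, hwc, ?_, ?_⟩)⟩
    · intro u hu huc
      have hcu : ConnectedAvoiding G w c u := by
        rcases huc with rfl | h
        · exact .refl
        · exact ConnectedAvoiding.tail .refl hcw h hu.ne'
      obtain ⟨a, h1, h2, h3⟩ := hfree u hu hcu
      exact ⟨a, ⟨hu, h1, h2.symm, h3⟩, (hpend u a hu hcu h1 h3 h2).dominated h1.ne'⟩
    · rintro x y z ⟨hxy, hyz, hxz, hn⟩ hc
      by_contra! hcon
      obtain ⟨⟨hx1, hx2⟩, ⟨hy1, hy2⟩, hz1, hz2⟩ := hcon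
      rcases hc with rfl | rfl | rfl
      -- When `c` is an end of the path, the other two vertices lie in its pendant clique. When `c`
      -- is the middle, `hone` makes its two outer neighbours adjacent.
      · have hy : ¬ G.Adj w y := fun h => hy2 h hxy
        exact hn (hpend x y hwc .refl hxy hy hy1 (.inl rfl)
          (.inr (ConnectedAvoiding.tail .refl hxy.ne' hyz hxz.symm)) hxz)
      · exact hn (hone y x z hwc .refl hxy.symm (fun h => hx2 h hxy.symm) hx1 hyz
          (fun h => hz2 h hyz) hz1 hxz)
      · have hy : ¬ G.Adj w y := fun h => hy2 h hyz.symm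
        exact hn (hpend z y hwc .refl hyz.symm hy hy1
          (.inr (ConnectedAvoiding.tail .refl hyz.ne hxy.symm hxz)) (.inl rfl) hxz)

theorem exists_ruleApplies [Finite V] (hG : HasCliqueBranches G) {x y z : V}
    (hp : IsInducedP3 G x y z) : ∃ v, RuleApplies G v := by
  by_cases h : ∃ p : V × V, G.Adj p.1 p.2 ∧ ¬ IsCliqueBranch G p.1 p.2
  · obtain ⟨p, hmin⟩ := Set.Finite.exists_minimalFor
      (fun p : V × V => {x | ConnectedAvoiding G p.1 p.2 x})
      {p : V × V | G.Adj p.1 p.2 ∧ ¬ IsCliqueBranch G p.1 p.2} (Set.toFinite _) h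
    refine exists_ruleApplies_of_minimal_branch hG hmin.1.1 hmin.1.2 fun u a hua hlt => ?_
    by_contra hbad
    exact hlt.2 (hmin.2 (j := (u, a)) ⟨hua, hbad⟩ hlt.1)
  · push Not at h
    exact ⟨y, .inl (dominatedEndsRule_of_forall_isCliqueBranch (fun w c => h (w, c)) hp)⟩

/-! ### Isolating the chosen vertices -/

/-- `G` with all the edges at vertices of `S` removed. -/
def isolate (G : SimpleGraph V) (S : Finset V) : SimpleGraph V where
  Adj x y := G.Adj x y ∧ x ∉ S ∧ y ∉ S
  symm := ⟨fun _ _ h => ⟨h.1.symm, h.2.2, h.2.1⟩⟩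
  loopless := ⟨fun _ h => h.1.ne rfl⟩

/-- A walk in the smaller graph is a walk in `G`, and the adjacency it yields joins two vertices
outside `S`. Thus blocks need not be examined again after a vertex is chosen. -/
theorem HasCliqueBranches.isolate (hG : HasCliqueBranches G) (S : Finset V) :
    HasCliqueBranches (isolate G S) := by
  intro w a b ha hb hne h
  exact ⟨hG w a b ha.1 hb.1 hne (Relation.ReflTransGen.mono (fun x y h => ⟨h.1.1, h.2⟩) _ _ h),
    ha.2.2, hb.2.2⟩

theorem isInducedP3_isolate_iff {S : Finset V} {x y z : V} :
    IsInducedP3 (isolate G S) x y z ↔ IsInducedP3 G x y z ∧ x ∉ S ∧ y ∉ S ∧ z ∉ S := by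
  simp only [IsInducedP3, isolate]
  tauto

theorem hitsP3_isolate_iff {S : Finset V} [DecidableEq V] {T : Finset V} :
    HitsP3 (isolate G S) T ↔ HitsP3 G (S ∪ T) := by
  simp only [HitsP3, isInducedP3_isolate_iff, Finset.mem_union]
  refine forall₃_congr fun x y z => ?_
  tauto

/-- Every hitting set can be replaced by one of at most the same size that includes `S`. -/
def IsExtendable (G : SimpleGraph V) (S : Finset V) : Prop :=
  ∀ T, HitsP3 G T → ∃ T', HitsP3 G T' ∧ S ⊆ T' ∧ T'.card ≤ T.card

/-- After passing to a hitting set that includes `S`, safety of `v` in the isolated graph is applied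
to the part outside `S`, and `S` is put back. -/
theorem IsExtendable.insert [DecidableEq V] [Finite V] {S : Finset V} {v : V}
    (hS : IsExtendable G S) (hv : RuleApplies (isolate G S) v) : IsExtendable G (insert v S) := by
  intro T hT
  obtain ⟨T₁, h1, h2, h3⟩ := hS T hT
  obtain ⟨T₂, h4, h5, h6⟩ := hv.isSafe (T₁ \ S) (by
    rw [hitsP3_isolate_iff, Finset.union_sdiff_of_subset h2]
    exact h1)
  refine ⟨S ∪ T₂, hitsP3_isolate_iff.1 h4, ?_, ?_⟩
  · rw [Finset.insert_subset_iff]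
    exact ⟨Finset.mem_union_right _ h5, Finset.subset_union_left⟩
  · have := Finset.card_union_le S T₂
    have := Finset.card_sdiff_add_card_eq_card h2
    omega

theorem RuleApplies.exists_adj {v : V} (h : RuleApplies G v) : ∃ u, G.Adj v u := by
  rcases h with ⟨a, b, h, -⟩ | ⟨a, u, h, -⟩ | ⟨u, h, -⟩
  · exact ⟨b, h.2.1⟩
  · exact ⟨a, h⟩
  · exact ⟨u, h⟩

theorem RuleApplies.notMem {S : Finset V} {v : V} (h : RuleApplies (isolate G S) v) : v ∉ S := by
  obtain ⟨u, hu⟩ := h.exists_adj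
  exact hu.2.1

theorem exists_ruleApplies_of_not_hitsP3 [Finite V] (hG : HasCliqueBranches G) {S : Finset V}
    (hS : ¬ HitsP3 G S) : ∃ v, RuleApplies (VertexDeletion.isolate G S) v := by
  unfold HitsP3 at hS
  push Not at hS
  obtain ⟨x, y, z, hp, hx, hy, hz⟩ := hS
  exact exists_ruleApplies (hG.isolate S) (isInducedP3_isolate_iff.2 ⟨hp, hx, hy, hz⟩)

end Graph

/-! ### Clique branches in block graphs -/

section Block

variable {V : Type*} {G : SimpleGraph V}

theorem reachable_induce_of_walk {U : Set V} {x y : V} (q : G.Walk x y)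
    (hU : ∀ z ∈ q.support, z ∈ U) :
    (G.induce U).Reachable ⟨x, hU x q.start_mem_support⟩ ⟨y, hU y q.end_mem_support⟩ := by
  induction q with
  | nil => exact .refl _
  | cons h q ih =>
    refine .trans (SimpleGraph.Adj.reachable ?_) (ih fun z hz => hU z (by simp [hz]))
    exact h

theorem reachable_induce_induce_of_walk {U : Set V} {v : U} {x y : V} (q : G.Walk x y)
    (hU : ∀ z ∈ q.support, z ∈ U) (hv : ∀ z ∈ q.support, z ≠ v) :
    ((G.induce U).induce ({v}ᶜ : Set U)).Reachable
      ⟨⟨x, hU x q.start_mem_support⟩, fun h => hv x q.start_mem_support (congrArg Subtype.val h)⟩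
      ⟨⟨y, hU y q.end_mem_support⟩, fun h => hv y q.end_mem_support (congrArg Subtype.val h)⟩ := by
  induction q with
  | nil => exact .refl _
  | cons h q ih =>
    refine .trans (SimpleGraph.Adj.reachable ?_)
      (ih (fun z hz => hU z (by simp [hz])) fun z hz => hv z (by simp [hz]))
    exact h

/-- Removing `v` cuts the path into two pieces, and `x` is joined to an end inside its piece. As no
vertex repeats, that piece avoids `v`. -/
theorem exists_walk_avoiding_of_isPath {a b v x : V} {p : G.Walk a b} (hp : p.IsPath)
    (hv : v ∈ p.support) (hx : x ∈ p.support) (hne : x ≠ v) :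
    (∃ q : G.Walk a x, q.support ⊆ p.support ∧ v ∉ q.support) ∨
      ∃ q : G.Walk b x, q.support ⊆ p.support ∧ v ∉ q.support := by
  classical
  have first : ∀ {a b : V} {p : G.Walk a b} (hp : p.IsPath) (hv : v ∈ p.support),
      x ∈ (p.takeUntil v hv).support → ∃ q : G.Walk a x, q.support ⊆ p.support ∧ v ∉ q.support := by
    intro a b p hp hv hx
    exact ⟨(p.takeUntil v hv).takeUntil x hx,
      fun _ hz => p.support_takeUntil_subset_support hv
        ((p.takeUntil v hv).support_takeUntil_subset_support hx hz),
      SimpleGraph.Walk.endpoint_notMem_support_takeUntil (hp.takeUntil hv) hx hne.symm⟩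
  have hx' := hx
  rw [← p.take_spec hv, SimpleGraph.Walk.mem_support_append_iff] at hx'
  refine hx'.imp (first hp hv) fun hx => ?_
  have hr : (p.dropUntil v hv).reverse.IsPath := (hp.dropUntil hv).reverse
  have hxr : x ∈ (p.dropUntil v hv).reverse.support := by simpa using hx
  refine ⟨(p.dropUntil v hv).reverse.takeUntil x hxr, ?_,
    SimpleGraph.Walk.endpoint_notMem_support_takeUntil hr hxr hne.symm⟩
  intro y hy
  exact p.support_dropUntil_subset_support hv
    (by simpa using SimpleGraph.Walk.support_takeUntil_subset_support _ hxr hy)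

/-- If a path joins two neighbours of a vertex `w` off the path, then `w` and the path
together induce a biconnected graph. -/
theorem isBiconnectedSet_insert_support {w a b : V} (p : G.Walk a b) (hp : p.IsPath)
    (hw : w ∉ p.support) (ha : G.Adj w a) (hb : G.Adj w b) :
    IsBiconnectedSet G (insert w {x | x ∈ p.support}) := by
  classical
  constructor
  · rw [SimpleGraph.connected_iff_exists_forall_reachable]
    refine ⟨⟨w, .inl rfl⟩, ?_⟩
    rintro ⟨x, rfl | hx⟩
    · exact .refl _
    · have h : ∀ z ∈ (SimpleGraph.Walk.cons ha (p.takeUntil x hx)).support,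
          z ∈ insert w {x | x ∈ p.support} := by
        intro z hz
        rw [SimpleGraph.Walk.support_cons, List.mem_cons] at hz
        exact hz.imp_right fun h => p.support_takeUntil_subset_support hx h
      exact reachable_induce_of_walk _ h
  · rintro ⟨v, hv⟩ ⟨⟨x, hxU⟩, ⟨y, hyU⟩, hx, hy, -, hn⟩
    have hx' : x ≠ v := fun h => hx (Subtype.ext h)
    have hy' : y ≠ v := fun h => hy (Subtype.ext h)
    apply hn
    -- If `w` is removed, the path keeps the rest connected. If a vertex of the path is removed,
    -- every other one still reaches an end of the path, and both ends are adjacent to `w`.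
    by_cases hvw : v = w
    · subst hvw
      have hxp : x ∈ p.support := hxU.resolve_left hx'
      have hyp : y ∈ p.support := hyU.resolve_left hy'
      have hsub : ∀ z ∈ ((p.takeUntil x hxp).reverse.append (p.takeUntil y hyp)).support,
          z ∈ p.support := by
        intro z hz
        rw [SimpleGraph.Walk.mem_support_append_iff, SimpleGraph.Walk.support_reverse,
          List.mem_reverse] at hz
        exact hz.elim (fun h => p.support_takeUntil_subset_support hxp h)
          fun h => p.support_takeUntil_subset_support hyp h
      refine reachable_induce_induce_of_walk _ (fun z hz => .inr (hsub z hz)) ?_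
      rintro z hz rfl
      exact hw (hsub _ hz)
    · have hvp : v ∈ p.support := hv.resolve_left hvw
      have key : ∀ z (hz : z ∈ insert w {x | x ∈ p.support}) (hzv : z ≠ v),
          ((G.induce (insert w {x | x ∈ p.support})).induce ({⟨v, hv⟩}ᶜ : Set _)).Reachable
            ⟨⟨w, .inl rfl⟩, fun h => hvw (congrArg Subtype.val h).symm⟩
            ⟨⟨z, hz⟩, fun h => hzv (congrArg Subtype.val h)⟩ := by
        have aux : ∀ (c z : V) (q : G.Walk c z), G.Adj w c → q.support ⊆ p.support →
            v ∉ q.support → ∃ q : G.Walk w z,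
              (∀ x ∈ q.support, x ∈ insert w {x | x ∈ p.support}) ∧ ∀ x ∈ q.support, x ≠ v := by
          intro c z q hc h1 h2
          refine ⟨.cons hc q, ?_, ?_⟩ <;> intro x hx <;>
            rw [SimpleGraph.Walk.support_cons, List.mem_cons] at hx
          · exact hx.imp_right fun h => h1 h
          · rcases hx with rfl | hx
            · exact fun h => hvw h.symm
            · exact fun h => h2 (h ▸ hx)
        intro z hz hzv
        rcases hz with rfl | hz
        · exact .refl _
        · obtain ⟨q, h1, h2⟩ : ∃ q : G.Walk w z,
              (∀ x ∈ q.support, x ∈ insert w {x | x ∈ p.support}) ∧ ∀ x ∈ q.support, x ≠ v := by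
            rcases exists_walk_avoiding_of_isPath hp hvp hz hzv with ⟨q, h1, h2⟩ | ⟨q, h1, h2⟩
            · exact aux a z q ha h1 h2
            · exact aux b z q hb h1 h2
          exact reachable_induce_induce_of_walk q h1 h2
      exact (key x hxU hx').symm.trans (key y hyU hy')

theorem ConnectedAvoiding.exists_isPath {w a b : V} (h : ConnectedAvoiding G w a b) (ha : a ≠ w) :
    ∃ p : G.Walk a b, p.IsPath ∧ w ∉ p.support := by
  classical
  obtain ⟨q, hq⟩ : ∃ q : G.Walk a b, w ∉ q.support := by
    induction h with
    | refl => exact ⟨.nil, by simpa using ha.symm⟩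
    | tail _ h ih =>
      obtain ⟨q, hq⟩ := ih
      exact ⟨q.concat h.1, by simpa [SimpleGraph.Walk.support_concat] using ⟨hq, h.2.2.symm⟩⟩
  exact ⟨q.bypass, q.bypass_isPath, fun h => hq (q.support_bypass_subset_support h)⟩

/-- The cycle formed by `w` and a path from `a` to `b` lies in a maximal biconnected set, which
exists by finiteness and is a clique. -/
theorem IsBlockGraph.hasCliqueBranches [Finite V] (hG : IsBlockGraph G) :
    HasCliqueBranches G := by
  intro w a b ha hb hne h
  obtain ⟨p, hp, hw⟩ := h.exists_isPath ha.ne'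
  obtain ⟨U, hsub, hU⟩ := (Set.toFinite {U | IsBiconnectedSet G U}).exists_le_maximal
    (isBiconnectedSet_insert_support p hp hw ha hb)
  exact hG U hU (hsub (.inr p.start_mem_support)) (hsub (.inr p.end_mem_support)) hne

end Block

/-! ### Structured stack programs and their machine code -/

section StackPrograms

open Turing

variable {K : Type} {Γ : K → Type} {σ : Type}

/-- Structured programs for a machine with stacks `Γ` and internal states `σ`. -/
inductive Prog (Γ : K → Type) (σ : Type) : Type
  | push (k : K) (f : σ → Γ k) : Prog Γ σ
  | peek (k : K) (f : σ → Option (Γ k) → σ) : Prog Γ σ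
  | pop (k : K) (f : σ → Option (Γ k) → σ) : Prog Γ σ
  | load (f : σ → σ) : Prog Γ σ
  | seq (p q : Prog Γ σ) : Prog Γ σ
  | ite (c : σ → Bool) (p q : Prog Γ σ) : Prog Γ σ
  | loop (c : σ → Bool) (p : Prog Γ σ) : Prog Γ σ

namespace Prog

/-- The labels of the machine code of a program. -/
def Label : Prog Γ σ → Type
  | seq p q => Label p ⊕ Label q
  | ite _ p q => Option (Label p ⊕ Label q)
  | loop _ p => Option (Label p)
  | push _ _ => Unit
  | peek _ _ => Unit
  | pop _ _ => Unit
  | load _ => Unit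

instance Label.finite : (p : Prog Γ σ) → Finite (Label p)
  | seq p q => by
    have := Label.finite p
    have := Label.finite q
    exact inferInstanceAs (Finite (Label p ⊕ Label q))
  | ite _ p q => by
    have := Label.finite p
    have := Label.finite q
    exact inferInstanceAs (Finite (Option (Label p ⊕ Label q)))
  | loop _ p => by
    have := Label.finite p
    exact inferInstanceAs (Finite (Option (Label p)))
  | push _ _ => inferInstanceAs (Finite Unit)
  | peek _ _ => inferInstanceAs (Finite Unit)
  | pop _ _ => inferInstanceAs (Finite Unit)
  | load _ => inferInstanceAs (Finite Unit)

/-- The label at which the machine code of a program is entered. -/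
def entry : (p : Prog Γ σ) → Label p
  | seq p _ => Sum.inl (entry p)
  | ite _ _ _ => (none : Option _)
  | loop _ _ => (none : Option _)
  | push _ _ => ()
  | peek _ _ => ()
  | pop _ _ => ()
  | load _ => ()

/-- The machine code of a program, with its labels renamed by `ι`, that continues at `e`. -/
def code {Λ : Type} : (p : Prog Γ σ) → (Label p → Λ) → Λ → Label p → TM2.Stmt Γ Λ σ
  | push k f, _, e, _ => .push k f (.goto fun _ => e)
  | peek k f, _, e, _ => .peek k f (.goto fun _ => e)
  | pop k f, _, e, _ => .pop k f (.goto fun _ => e)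
  | load f, _, e, _ => .load f (.goto fun _ => e)
  | seq p q, ι, e, l => Sum.elim
      (code p (fun l => ι (Sum.inl l)) (ι (Sum.inr (entry q))))
      (code q (fun l => ι (Sum.inr l)) e) l
  | ite c p q, ι, e, l => Option.elim l
      (.branch c (.goto fun _ => ι (some (Sum.inl (entry p))))
        (.goto fun _ => ι (some (Sum.inr (entry q)))))
      (Sum.elim (code p (fun l => ι (some (Sum.inl l))) e)
        (code q (fun l => ι (some (Sum.inr l))) e))
  | loop c p, ι, e, l => Option.elim l
      (.branch c (.goto fun _ => ι (some (entry p))) (.goto fun _ => e))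
      (code p (fun l => ι (some l)) (ι none))

variable [DecidableEq K]

/-- `Exec p s t s'`: started in `s`, the program `p` stops in `s'` after `t` steps. -/
inductive Exec : Prog Γ σ → σ × (∀ k, List (Γ k)) → ℕ → σ × (∀ k, List (Γ k)) → Prop
  | push (k f v S) : Exec (push k f) (v, S) 1 (v, Function.update S k (f v :: S k))
  | peek (k f v S) : Exec (peek k f) (v, S) 1 (f v (S k).head?, S)
  | pop (k f v S) :
    Exec (pop k f) (v, S) 1 (f v (S k).head?, Function.update S k (S k).tail)
  | load (f v S) : Exec (load f) (v, S) 1 (f v, S)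
  | seq {p q s₁ s₂ s₃ t₁ t₂} : Exec p s₁ t₁ s₂ → Exec q s₂ t₂ s₃ →
    Exec (seq p q) s₁ (t₁ + t₂) s₃
  | ite_true {c p q s s' t} : c s.1 = true → Exec p s t s' → Exec (ite c p q) s (1 + t) s'
  | ite_false {c p q s s' t} : c s.1 = false → Exec q s t s' → Exec (ite c p q) s (1 + t) s'
  | loop_true {c p s₁ s₂ s₃ t₁ t₂} : c s₁.1 = true → Exec p s₁ t₁ s₂ →
    Exec (loop c p) s₂ t₂ s₃ → Exec (loop c p) s₁ (1 + t₁ + t₂) s₃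
  | loop_false {c p s} : c s.1 = false → Exec (loop c p) s 1 s

/-- Every label carries a single command or test followed by jumps, so the step counts agree
exactly. The renaming `ι` and the exit `e` are arbitrary so that the induction can pass to
subprograms sitting inside a larger machine. -/
theorem Exec.iterate_step {Λ : Type} {M : Λ → TM2.Stmt Γ Λ σ} {p : Prog Γ σ}
    {s s' : σ × (∀ k, List (Γ k))} {t : ℕ} (h : Exec p s t s') :
    ∀ (ι : Label p → Λ) (e : Λ), (∀ l, M (ι l) = code p ι e l) →
      (flip bind (TM2.step M))^[t] (some ⟨some (ι (entry p)), s.1, s.2⟩) =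
        some ⟨some e, s'.1, s'.2⟩ := by
  induction h with
  | push k f v S => intro ι e hM; simp [flip, TM2.step, hM, code]
  | peek k f v S => intro ι e hM; simp [flip, TM2.step, hM, code]
  | pop k f v S => intro ι e hM; simp [flip, TM2.step, hM, code]
  | load f v S => intro ι e hM; simp [flip, TM2.step, hM, code]
  | @seq p q s₁ s₂ s₃ t₁ t₂ _ _ ih₁ ih₂ =>
    intro ι e hM
    rw [Nat.add_comm, Function.iterate_add_apply]
    refine Eq.trans (congrArg _ (ih₁ (fun l => ι (Sum.inl l)) (ι (Sum.inr (entry q)))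
      fun l => hM (Sum.inl l))) ?_
    exact ih₂ (fun l => ι (Sum.inr l)) e fun l => hM (Sum.inr l)
  | @ite_true c p q s s' t hc _ ih =>
    intro ι e hM
    rw [Nat.add_comm, Function.iterate_add_apply]
    refine Eq.trans (congrArg _ ?_) (ih (fun l => ι (some (Sum.inl l))) e
      fun l => hM (some (Sum.inl l)))
    have h0 := hM (none : Option _)
    simp only [code, Option.elim_none] at h0
    simp [flip, entry, h0, hc]
  | @ite_false c p q s s' t hc _ ih =>
    intro ι e hM
    rw [Nat.add_comm, Function.iterate_add_apply]
    refine Eq.trans (congrArg _ ?_) (ih (fun l => ι (some (Sum.inr l))) e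
      fun l => hM (some (Sum.inr l)))
    have h0 := hM (none : Option _)
    simp only [code, Option.elim_none] at h0
    simp [flip, entry, h0, hc]
  | @loop_true c p s₁ s₂ s₃ t₁ t₂ hc _ _ ih₁ ih₂ =>
    intro ι e hM
    rw [Nat.add_comm, Nat.add_comm 1, Function.iterate_add_apply, Function.iterate_add_apply]
    refine Eq.trans (congrArg _ (Eq.trans (congrArg _ ?_) (ih₁ (fun l => ι (some l)) (ι none)
      fun l => hM (some l)))) (ih₂ ι e hM)
    have h0 := hM (none : Option _)
    simp only [code, Option.elim_none] at h0
    simp [flip, entry, h0, hc]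
  | @loop_false c p s hc =>
    intro ι e hM
    have h0 := hM (none : Option _)
    simp only [code, Option.elim_none] at h0
    simp [flip, entry, h0, hc]

/-- Started in `s`, the program `p` stops in `s'` after at most `T` steps. -/
def Runs (p : Prog Γ σ) (s : σ × (∀ k, List (Γ k))) (T : ℕ) (s' : σ × (∀ k, List (Γ k))) : Prop :=
  ∃ t ≤ T, Exec p s t s'

theorem Runs.mono {p : Prog Γ σ} {s s' : σ × (∀ k, List (Γ k))} {T T' : ℕ}
    (h : Runs p s T s') (hT : T ≤ T') : Runs p s T' s' :=
  h.imp fun _ h => ⟨h.1.trans hT, h.2⟩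

theorem Runs.seq {p q : Prog Γ σ} {s₁ s₂ s₃ : σ × (∀ k, List (Γ k))} {T₁ T₂ : ℕ}
    (hp : Runs p s₁ T₁ s₂) (hq : Runs q s₂ T₂ s₃) : Runs (seq p q) s₁ (T₁ + T₂) s₃ := by
  obtain ⟨t₁, h₁, h₁'⟩ := hp
  obtain ⟨t₂, h₂, h₂'⟩ := hq
  exact ⟨_, Nat.add_le_add h₁ h₂, h₁'.seq h₂'⟩

theorem Runs.ite_true {c : σ → Bool} {p q : Prog Γ σ} {s s' : σ × (∀ k, List (Γ k))} {T : ℕ}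
    (hc : c s.1 = true) (h : Runs p s T s') : Runs (ite c p q) s (1 + T) s' := by
  obtain ⟨t, ht, h⟩ := h
  exact ⟨_, Nat.add_le_add_left ht 1, h.ite_true hc⟩

theorem Runs.ite_false {c : σ → Bool} {p q : Prog Γ σ} {s s' : σ × (∀ k, List (Γ k))} {T : ℕ}
    (hc : c s.1 = false) (h : Runs q s T s') : Runs (ite c p q) s (1 + T) s' := by
  obtain ⟨t, ht, h⟩ := h
  exact ⟨_, Nat.add_le_add_left ht 1, h.ite_false hc⟩

/-- A loop that goes through the states `s 0, …, s m`. -/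
theorem Runs.loop {c : σ → Bool} {p : Prog Γ σ} (m : ℕ) {T : ℕ} :
    ∀ (s : ℕ → σ × (∀ k, List (Γ k))), (∀ j < m, c (s j).1 = true) → c (s m).1 = false →
      (∀ j < m, Runs p (s j) T (s (j + 1))) → Runs (loop c p) (s 0) (m * (T + 1) + 1) (s m) := by
  induction m with
  | zero => exact fun s _ h _ => ⟨1, by simp, .loop_false h⟩
  | succ m ih =>
    intro s h1 h2 h3
    obtain ⟨t₁, ht₁, h₁⟩ := h3 0 (Nat.succ_pos m)
    obtain ⟨t₂, ht₂, h₂⟩ := ih (fun j => s (j + 1)) (fun j hj => h1 _ (by omega)) h2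
      fun j hj => h3 _ (by omega)
    refine ⟨_, ?_, .loop_true (h1 0 (Nat.succ_pos m)) h₁ h₂⟩
    rw [Nat.succ_mul]
    omega

theorem runs_push (k : K) (f : σ → Γ k) (v S) :
    Runs (push k f) (v, S) 1 (v, Function.update S k (f v :: S k)) :=
  ⟨1, le_rfl, .push k f v S⟩

theorem runs_peek (k : K) (f : σ → Option (Γ k) → σ) (v S) :
    Runs (peek k f) (v, S) 1 (f v (S k).head?, S) :=
  ⟨1, le_rfl, .peek k f v S⟩

theorem runs_pop (k : K) (f : σ → Option (Γ k) → σ) (v S) :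
    Runs (pop k f) (v, S) 1 (f v (S k).head?, Function.update S k (S k).tail) :=
  ⟨1, le_rfl, .pop k f v S⟩

theorem runs_load (f : σ → σ) (v) (S : ∀ k, List (Γ k)) : Runs (load f) (v, S) 1 (f v, S) :=
  ⟨1, le_rfl, .load f v S⟩

end Prog

/-- The machine that runs a program, with input on the stack `k₀` and output on `k₁`. -/
noncomputable def machine [DecidableEq K] [Fintype K] [Fintype σ] (k₀ k₁ : K)
    [Fintype (Γ k₀)] (v₀ : σ) (p : Prog Γ σ) : FinTM2 where
  K := K
  k₀ := k₀
  k₁ := k₁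
  Γ := Γ
  Λ := Option p.Label
  main := some p.entry
  ΛFin := Fintype.ofFinite _
  σ := σ
  initialState := v₀
  -- The additional label `none` is the exit of the program; halting there costs one more step.
  m := fun l => l.elim .halt (p.code some none)

theorem dite_eq_update [DecidableEq K] (k₀ : K) (x : List (Γ k₀)) :
    (fun k => if h : k = k₀ then Eq.mpr (congrArg (fun k => List (Γ k)) h) x else []) =
      Function.update (fun _ => []) k₀ x := by
  funext k
  by_cases hk : k = k₀
  · subst hk
    simp
  · simp [hk]

/-- The final configuration in `haltList` has the initial internal state and all stacks but the
output stack empty, so the program has to clean up after itself. -/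
theorem Prog.Runs.outputs [DecidableEq K] [Fintype K] [Fintype σ] {k₀ k₁ : K}
    [Fintype (Γ k₀)] {v₀ : σ} {p : Prog Γ σ} {x : List (Γ k₀)} {y : List (Γ k₁)} {T : ℕ}
    (h : p.Runs (v₀, Function.update (fun _ => []) k₀ x) T
      (v₀, Function.update (fun _ => []) k₁ y)) :
    Nonempty (TM2OutputsInTime (machine k₀ k₁ v₀ p) x (some y) (T + 1)) := by
  obtain ⟨t, ht, h⟩ := h
  refine ⟨⟨⟨t + 1, ?_⟩, Nat.succ_le_succ ht⟩⟩
  have h1 := h.iterate_step (M := (machine k₀ k₁ v₀ p).m) some none fun _ => rfl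
  have hi : initList (machine k₀ k₁ v₀ p) x =
      ⟨some (some p.entry), v₀, Function.update (fun _ => []) k₀ x⟩ :=
    congrArg (TM2.Cfg.mk _ _) (dite_eq_update k₀ x)
  have ho : haltList (machine k₀ k₁ v₀ p) y =
      ⟨none, v₀, Function.update (fun _ => []) k₁ y⟩ :=
    congrArg (TM2.Cfg.mk _ _) (dite_eq_update k₁ y)
  rw [hi, Nat.add_comm, Function.iterate_add_apply]
  refine Eq.trans (congrArg _ h1) (Eq.trans ?_ (congrArg some ho.symm))
  rfl

end StackPrograms

/-! ### Stacks, control states and timed program specifications -/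

/-- The stacks of the machine: the input word and the two bit arrays `arr true` (the output) and
`arr false` are kept on pairs of stacks, and the unary registers on pairs `left i`, `right i`. -/
inductive Stack (r : ℕ) : Type
  | inp | inp' | tmp
  | arr (b : Bool)
  | arr' (b : Bool)
  | left (i : Fin r)
  | right (i : Fin r)
  deriving DecidableEq, Fintype

/-- The stack alphabets. -/
abbrev Stack.Alphabet {r : ℕ} : Stack r → Type
  | inp => Option Bool
  | inp' => Option Bool
  | tmp => Bool
  | arr _ => Bool
  | arr' _ => Bool
  | left _ => Bool
  | right _ => Bool

/-- The internal states of the machine. -/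
structure Control where
  /-- the result of the last test -/
  flag : Bool
  /-- whether the stack that controls the current loop is nonempty -/
  more : Bool
  /-- the symbol that is being moved -/
  sym : Option Bool
  deriving Fintype

namespace Stack

variable {r : ℕ}

/-- Symbols as elements of a common alphabet. -/
def enc : (k : Stack r) → k.Alphabet → Option Bool
  | inp, x => x
  | inp', x => x
  | tmp, x => some x
  | arr _, x => some x
  | arr' _, x => some x
  | left _, x => some x
  | right _, x => some x

/-- A left inverse of `Stack.enc`. -/
def dec : (k : Stack r) → Option Bool → k.Alphabet
  | inp, x => x
  | inp', x => x
  | tmp, x => x.getD false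
  | arr _, x => x.getD false
  | arr' _, x => x.getD false
  | left _, x => x.getD false
  | right _, x => x.getD false

end Stack

/-- Programs of the machine. -/
abbrev Program (r : ℕ) := Prog (Stack.Alphabet (r := r)) Control

namespace Program

open Stack Prog

variable {r : ℕ}

/-- `p` takes the flag `f` and the stacks `S` to the flag `f'` and the stacks `S'` in at most
`T` steps. -/
def Does (p : Program r) (f : Bool) (S : ∀ k : Stack r, List k.Alphabet) (T : ℕ) (f' : Bool)
    (S' : ∀ k : Stack r, List k.Alphabet) : Prop :=
  ∀ v : Control, v.flag = f → ∃ v' : Control, v'.flag = f' ∧ p.Runs (v, S) T (v', S')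

variable {p q : Program r} {f f₁ f₂ f₃ : Bool} {T T₁ T₂ : ℕ}
  {S S₁ S₂ S₃ : ∀ k : Stack r, List k.Alphabet}

theorem Does.mono (h : Does p f₁ S₁ T₁ f₂ S₂) (hT : T₁ ≤ T₂) : Does p f₁ S₁ T₂ f₂ S₂ :=
  fun v hv => (h v hv).imp fun _ h => ⟨h.1, h.2.mono hT⟩

/-- A specification holds for all control states with the given flag, so the scratch fields `more`
and `sym` need not match at the joint. -/
theorem Does.seq (hp : Does p f₁ S₁ T₁ f₂ S₂) (hq : Does q f₂ S₂ T₂ f₃ S₃) :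
    Does (p.seq q) f₁ S₁ (T₁ + T₂) f₃ S₃ := by
  intro v hv
  obtain ⟨v₂, h₂, hr₂⟩ := hp v hv
  obtain ⟨v₃, h₃, hr₃⟩ := hq v₂ h₂
  exact ⟨v₃, h₃, hr₂.seq hr₃⟩

/-- Set the flag to a fixed value. -/
def setFlag (f : Bool) : Program r := .load fun v => { v with flag := f }

theorem does_setFlag (f f' : Bool) (S : ∀ k : Stack r, List k.Alphabet) :
    Does (setFlag f') f S 1 f' S :=
  fun _ _ => ⟨_, rfl, runs_load _ _ _⟩

/-- Run `p` if the flag is set, and otherwise `q`. -/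
def ifFlag (p q : Program r) : Program r := .ite Control.flag p q

theorem does_ifFlag_true (h : Does p true S₁ T f₂ S₂) :
    Does (ifFlag p q) true S₁ (1 + T) f₂ S₂ :=
  fun v hv => (h v hv).imp fun _ h => ⟨h.1, .ite_true hv h.2⟩

theorem does_ifFlag_false (h : Does q false S₁ T f₂ S₂) :
    Does (ifFlag p q) false S₁ (1 + T) f₂ S₂ :=
  fun v hv => (h v hv).imp fun _ h => ⟨h.1, .ite_false hv h.2⟩

/-- Repeat `p` as long as the flag is set. -/
def whileFlag (p : Program r) : Program r := .loop Control.flag p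

theorem does_whileFlag (m : ℕ) : ∀ S : ℕ → ∀ k : Stack r, List k.Alphabet,
    (∀ j < m, Does p true (S j) T (decide (j + 1 < m)) (S (j + 1))) →
      Does (whileFlag p) (decide (0 < m)) (S 0) (m * (T + 1) + 1) false (S m) := by
  induction m with
  | zero => exact fun S _ v hv => ⟨v, hv, 1, by omega, .loop_false hv⟩
  | succ m ih =>
    intro S h v hv
    obtain ⟨v₁, hv₁, t₁, ht₁, h₁⟩ := h 0 (Nat.succ_pos m) v (by simpa using hv)
    obtain ⟨v₂, hv₂, t₂, ht₂, h₂⟩ := ih (fun j => S (j + 1))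
      (fun j hj => by simpa using h (j + 1) (by omega)) v₁ (by simpa using hv₁)
    refine ⟨v₂, hv₂, _, ?_, .loop_true (by simpa using hv) h₁ h₂⟩
    rw [Nat.succ_mul]
    omega

/-- Record whether the stack `k` is nonempty. -/
def check (k : Stack r) : Program r := .peek k fun v o => { v with more := o.isSome }

theorem runs_check (k : Stack r) (v : Control) (S : ∀ k : Stack r, List k.Alphabet) :
    (check k).Runs (v, S) 1 ({ v with more := (S k).head?.isSome }, S) :=
  runs_peek k _ v S

/-- Repeat `p` as long as the stack `k` is nonempty. -/
def whileNonempty (k : Stack r) (p : Program r) : Program r :=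
  (check k).seq (.loop Control.more (p.seq (check k)))

theorem does_whileNonempty {k : Stack r} (m : ℕ) (S : ℕ → ∀ k : Stack r, List k.Alphabet)
    (h1 : ∀ j < m, S j k ≠ []) (h2 : S m k = [])
    (h3 : ∀ j < m, Does p f (S j) T f (S (j + 1))) :
    Does (whileNonempty k p) f (S 0) (m * (T + 2) + 2) f (S m) := by
  -- Each round costs the body, one loop test and one check. The check at the end of a round renews
  -- `more`, which the body may have overwritten.
  have key : ∀ (m : ℕ) (S : ℕ → ∀ k : Stack r, List k.Alphabet),
      (∀ j < m, S j k ≠ []) → S m k = [] → (∀ j < m, Does p f (S j) T f (S (j + 1))) →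
      ∀ v : Control, v.flag = f → v.more = (S 0 k).head?.isSome → ∃ v' : Control, v'.flag = f ∧
        (Prog.loop Control.more (p.seq (check k))).Runs (v, S 0) (m * (T + 2) + 1) (v', S m) := by
    intro m
    induction m with
    | zero =>
      intro S _ h2 _ v hv hm
      exact ⟨v, hv, 1, by omega, .loop_false (by simp [hm, h2])⟩
    | succ m ih =>
      intro S h1 h2 h3 v hv hm
      obtain ⟨v₁, hv₁, t₁, ht₁, hr₁⟩ := h3 0 (Nat.succ_pos m) v hv
      obtain ⟨t₂, ht₂, hr₂⟩ := runs_check k v₁ (S 1)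
      obtain ⟨v₃, hv₃, t₃, ht₃, hr₃⟩ := ih (fun j => S (j + 1)) (fun j hj => h1 _ (by omega)) h2
        (fun j hj => h3 _ (by omega)) { v₁ with more := (S 1 k).head?.isSome } hv₁ rfl
      refine ⟨v₃, hv₃, _, ?_, .loop_true ?_ (hr₁.seq hr₂) hr₃⟩
      · rw [Nat.succ_mul]
        omega
      · have := h1 0 (Nat.succ_pos m)
        rw [hm, List.isSome_head?]
        simpa using this
  intro v hv
  obtain ⟨v', hv', hr⟩ := key m S h1 h2 h3 { v with more := (S 0 k).head?.isSome } hv rfl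
  exact ⟨v', hv', ((runs_check k v (S 0)).seq hr).mono (by omega)⟩

/-- Move the top symbol of `k` to `k'`. -/
def move (k k' : Stack r) : Program r :=
  (Prog.pop k fun v o => { v with sym := o.bind k.enc }).seq (.push k' fun v => k'.dec v.sym)

/-- Move the top symbol of `inp` to `inp'`, and record whether it is different from `none`. -/
def scan : Program r := (move inp inp').seq (.load fun v => { v with flag := v.sym.isSome })

theorem runs_move {k k' : Stack r} (hne : k ≠ k') (v : Control) {x : k.Alphabet}
    {xs : List k.Alphabet} (h : S k = x :: xs) :
    (move k k').Runs (v, S) 2 ({ v with sym := k.enc x },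
      Function.update (Function.update S k xs) k' (k'.dec (k.enc x) :: S k')) := by
  have h1 := runs_pop k (fun (v : Control) o => { v with sym := o.bind k.enc }) v S
  have h2 := runs_push k' (fun v : Control => k'.dec v.sym) { v with sym := k.enc x }
    (Function.update S k xs)
  simp only [h, List.head?_cons, Option.bind_some, List.tail_cons] at h1
  rw [Function.update_of_ne hne.symm] at h2
  exact h1.seq h2

theorem does_move {k k' : Stack r} (hne : k ≠ k') (f : Bool) {x : k.Alphabet}
    {xs : List k.Alphabet} (h : S k = x :: xs) :
    Does (move k k') f S 2 f
      (Function.update (Function.update S k xs) k' (k'.dec (k.enc x) :: S k')) :=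
  fun v hv => ⟨{ v with sym := k.enc x }, hv, runs_move hne v h⟩

end Program

/-! ### Stack contents as positions and counters -/

/-- The contents of the memory: a word, of which the first `pos` symbols are on the stack `inp'`,
two arrays, of which the first `apos` bits are on the stacks `arr'`, and unary counters. -/
@[ext]
structure Memory (r : ℕ) where
  /-- the input word -/
  word : List (Option Bool)
  /-- the position in the input word -/
  pos : ℕ
  /-- the arrays -/
  val : Bool → List Bool
  /-- the positions in the arrays -/
  apos : Bool → ℕ
  /-- the contents of the stacks `left i` -/
  left : Fin r → ℕ
  /-- the contents of the stacks `right i` -/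
  right : Fin r → ℕ
  /-- the contents of the stack `tmp` -/
  tmp : ℕ

namespace Memory

variable {r : ℕ}

/-- The stacks that represent the contents of the memory. -/
def toStacks (m : Memory r) : ∀ k : Stack r, List k.Alphabet
  | .inp => m.word.drop m.pos
  | .inp' => (m.word.take m.pos).reverse
  | .tmp => List.replicate m.tmp false
  | .arr b => (m.val b).drop (m.apos b)
  | .arr' b => ((m.val b).take (m.apos b)).reverse
  | .left i => List.replicate (m.left i) false
  | .right i => List.replicate (m.right i) false

end Memory

namespace Program

open Stack Prog

variable {r : ℕ} (m : Memory r) (f : Bool)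

theorem take_succ_reverse {α : Type*} {l : List α} {p : ℕ} (h : p < l.length) :
    (l.take (p + 1)).reverse = l[p] :: (l.take p).reverse := by
  rw [List.take_succ_eq_append_getElem h, List.reverse_append]
  rfl

theorem update_update_stacks_eq {m m' : Memory r} {k k' : Stack r} {l l'} (hne : k ≠ k')
    (hk : m'.toStacks k = l) (hk' : m'.toStacks k' = l')
    (h : ∀ j, j ≠ k → j ≠ k' → m'.toStacks j = m.toStacks j) :
    Function.update (Function.update m.toStacks k l) k' l' = m'.toStacks := by
  funext j
  by_cases h1 : j = k'
  · subst h1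
    simp [hk']
  · rw [Function.update_of_ne h1]
    by_cases h2 : j = k
    · subst h2
      simp [hk]
    · rw [Function.update_of_ne h2, h j h2 h1]

theorem does_move_memory {m m' : Memory r} {k k' : Stack r} (hne : k ≠ k') {x : k.Alphabet}
    (h : m.toStacks k = x :: m'.toStacks k)
    (h' : m'.toStacks k' = k'.dec (k.enc x) :: m.toStacks k')
    (hj : ∀ j, j ≠ k → j ≠ k' → m'.toStacks j = m.toStacks j) :
    Does (move k k') f m.toStacks 2 f m'.toStacks := by
  rw [← update_update_stacks_eq hne rfl rfl hj, h']
  exact does_move hne f h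

theorem Does.of_eq {m₁ m₁' m₂ m₂' : Memory r} {p : Program r} {f₁ f₂ : Bool} {T T' : ℕ}
    (h : Does p f₁ m₁.toStacks T f₂ m₂.toStacks) (h1 : m₁' = m₁) (hT : T ≤ T') (h2 : m₂' = m₂) :
    Does p f₁ m₁'.toStacks T' f₂ m₂'.toStacks := by
  subst h1 h2
  exact h.mono hT

theorem does_move_inp (h : m.pos < m.word.length) :
    Does (move inp inp') f m.toStacks 2 f { m with pos := m.pos + 1 }.toStacks := by
  refine does_move_memory f (by simp) (x := m.word[m.pos]) ?_ ?_ ?_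
  · exact List.drop_eq_getElem_cons h
  · exact take_succ_reverse h
  · intro j; cases j <;> simp [Memory.toStacks]

theorem does_move_inp' {p : ℕ} (h : m.pos = p + 1) (hp : p < m.word.length) :
    Does (move inp' inp) f m.toStacks 2 f { m with pos := p }.toStacks := by
  refine does_move_memory f (by simp) (x := m.word[p]) ?_ ?_ ?_
  · simp only [Memory.toStacks, h]
    exact take_succ_reverse hp
  · simp only [Memory.toStacks, h]
    exact List.drop_eq_getElem_cons hp
  · intro j; cases j <;> simp [Memory.toStacks]

theorem does_move_arr (b : Bool) (h : m.apos b < (m.val b).length) :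
    Does (move (arr b) (arr' b)) f m.toStacks 2 f
      { m with apos := Function.update m.apos b (m.apos b + 1) }.toStacks := by
  refine does_move_memory f (by simp) (x := (m.val b)[m.apos b]) ?_ ?_ ?_
  · simp only [Memory.toStacks, Function.update_self]
    exact List.drop_eq_getElem_cons h
  · simp only [Memory.toStacks, Function.update_self]
    exact take_succ_reverse h
  · intro j; cases j <;> simp +contextual [Memory.toStacks, Function.update_of_ne]

theorem does_move_arr' (b : Bool) {p : ℕ} (h : m.apos b = p + 1) (hp : p < (m.val b).length) :
    Does (move (arr' b) (arr b)) f m.toStacks 2 f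
      { m with apos := Function.update m.apos b p }.toStacks := by
  refine does_move_memory f (by simp) (x := (m.val b)[p]) ?_ ?_ ?_
  · simp only [Memory.toStacks, h, Function.update_self]
    exact take_succ_reverse hp
  · simp only [Memory.toStacks, h, Function.update_self]
    exact List.drop_eq_getElem_cons hp
  · intro j; cases j <;> simp +contextual [Memory.toStacks, Function.update_of_ne]

theorem does_move_left_tmp (x : Fin r) {c : ℕ} (h : m.left x = c + 1) :
    Does (move (left x) tmp) f m.toStacks 2 f
      { m with left := Function.update m.left x c, tmp := m.tmp + 1 }.toStacks := by
  refine does_move_memory f (by simp) (x := false) ?_ ?_ ?_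
  · simp [Memory.toStacks, h, List.replicate_succ]
  · simp [Memory.toStacks, List.replicate_succ, dec, enc]
  · intro j; cases j <;> simp +contextual [Memory.toStacks, Function.update_of_ne]

theorem does_move_tmp_left (x : Fin r) {c : ℕ} (h : m.tmp = c + 1) :
    Does (move tmp (left x)) f m.toStacks 2 f
      { m with left := Function.update m.left x (m.left x + 1), tmp := c }.toStacks := by
  refine does_move_memory f (by simp) (x := false) ?_ ?_ ?_
  · simp [Memory.toStacks, h, List.replicate_succ]
  · simp [Memory.toStacks, List.replicate_succ, dec, enc]
  · intro j; cases j <;> simp +contextual [Memory.toStacks, Function.update_of_ne]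

theorem does_move_right_left (x : Fin r) {c : ℕ} (h : m.right x = c + 1) :
    Does (move (right x) (left x)) f m.toStacks 2 f
      { m with
        left := Function.update m.left x (m.left x + 1)
        right := Function.update m.right x c }.toStacks := by
  refine does_move_memory f (by simp) (x := false) ?_ ?_ ?_
  · simp [Memory.toStacks, h, List.replicate_succ]
  · simp [Memory.toStacks, List.replicate_succ, dec, enc]
  · intro j; cases j <;> simp +contextual [Memory.toStacks, Function.update_of_ne]

theorem does_move_left_right (x : Fin r) {c : ℕ} (h : m.left x = c + 1) :
    Does (move (left x) (right x)) f m.toStacks 2 f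
      { m with
        left := Function.update m.left x c
        right := Function.update m.right x (m.right x + 1) }.toStacks := by
  refine does_move_memory f (by simp) (x := false) ?_ ?_ ?_
  · simp [Memory.toStacks, h, List.replicate_succ]
  · simp [Memory.toStacks, List.replicate_succ, dec, enc]
  · intro j; cases j <;> simp +contextual [Memory.toStacks, Function.update_of_ne]

theorem does_scan (h : m.pos < m.word.length) :
    Does scan f m.toStacks 3 m.word[m.pos].isSome { m with pos := m.pos + 1 }.toStacks := by
  have hm : Function.update (Function.update m.toStacks inp (m.word.drop (m.pos + 1))) inp'
      (m.word[m.pos] :: m.toStacks inp') = { m with pos := m.pos + 1 }.toStacks := by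
    refine update_update_stacks_eq (by simp) rfl (take_succ_reverse h) ?_
    intro j; cases j <;> simp [Memory.toStacks]
  intro v _
  have h1 := runs_move (k := inp) (k' := inp') (by simp) v (S := m.toStacks) (x := m.word[m.pos])
    (xs := m.word.drop (m.pos + 1)) (List.drop_eq_getElem_cons h)
  refine ⟨⟨m.word[m.pos].isSome, v.more, m.word[m.pos]⟩, rfl, ?_⟩
  rw [← hm]
  exact h1.seq (runs_load _ _ _)

end Program

/-! ### Positions in the adjacency word -/

section Words

theorem getElem?_flatMap_finRange {α : Type*} {n k : ℕ} (f : Fin n → List α)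
    (hf : ∀ i, (f i).length = k) (i : Fin n) {j : ℕ} (hj : j < k) :
    ((List.finRange n).flatMap f)[(i : ℕ) * k + j]? = (f i)[j]? := by
  induction n with
  | zero => exact i.elim0
  | succ n ih =>
    rw [List.finRange_succ, List.flatMap_cons, List.flatMap_map]
    refine Fin.cases ?_ (fun i => ?_) i
    · rw [List.getElem?_append_left (by simp [hf, hj])]
      simp
    · rw [List.getElem?_append_right (by rw [hf, Fin.val_succ, Nat.succ_mul]; omega), hf,
        Fin.val_succ, Nat.succ_mul, ← ih (fun i => f i.succ) (fun i => hf _) i]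
      congr 1
      omega

variable {n : ℕ} (G : SimpleGraph (Fin n))

theorem length_encodeGraph : (encodeGraph G).length = n * (n + 1) := by
  simp [encodeGraph, List.length_flatMap]

open Classical in
theorem getElem?_encodeGraph (i : Fin n) {j : ℕ} (hj : j ≤ n) :
    (encodeGraph G)[(i : ℕ) * (n + 1) + j]? =
      some (if h : j < n then some (decide (G.Adj i ⟨j, h⟩)) else none) := by
  rw [encodeGraph, getElem?_flatMap_finRange (k := n + 1) _ (by simp) i (by omega)]
  by_cases h : j < n
  · rw [List.getElem?_append_left (by simpa using h)]
    simp [h]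
  · obtain rfl : j = n := by omega
    simp

theorem row_add_lt {i j n : ℕ} (hi : i < n) (hj : j ≤ n) : i * (n + 1) + j < n * (n + 1) := by
  have := Nat.mul_le_mul_right (n + 1) (Nat.succ_le_of_lt hi)
  rw [Nat.succ_mul] at this
  omega

theorem isSome_getElem_encodeGraph {i j : ℕ} (hi : i < n) (hj : j ≤ n)
    (h : i * (n + 1) + j < (encodeGraph G).length) :
    (encodeGraph G)[i * (n + 1) + j].isSome = decide (j < n) := by
  have := getElem?_encodeGraph G ⟨i, hi⟩ hj
  rw [List.getElem?_eq_getElem h, Option.some_inj] at this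
  rw [this]
  by_cases h : j < n <;> simp [h]

end Words

/-! ### Access to the arrays and to the adjacency matrix -/

namespace Program

open Stack Prog

variable {r n : ℕ} {m : Memory r} {f : Bool} {b : Bool} {x y : Fin r} {i : ℕ}

/-- Go to the entry of the array `b` with the index in the register `x`. -/
def seekArr (b : Bool) (x : Fin r) : Program r :=
  whileNonempty (left x) ((move (left x) tmp).seq (move (arr b) (arr' b)))

/-- One cell is passed for each unit of the register. The units are kept on `tmp`, where they later
measure the way back. -/
theorem does_seekArr (hx : m.left x = i) (ht : m.tmp = 0) (hp : m.apos b = 0)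
    (hi : i ≤ (m.val b).length) :
    Does (seekArr b x) f m.toStacks (i * 6 + 2) f
      { m with
        left := Function.update m.left x 0
        apos := Function.update m.apos b i
        tmp := i }.toStacks := by
  subst hx
  refine (does_whileNonempty (T := 4) (m.left x)
    (fun j => Memory.toStacks { m with
      left := Function.update m.left x (m.left x - j)
      apos := Function.update m.apos b j
      tmp := j }) ?_ ?_ ?_).of_eq ?_ le_rfl ?_
  · intro j hj
    simp [Memory.toStacks, Nat.sub_eq_zero_iff_le, hj]
  · simp [Memory.toStacks]
  · intro j hj
    refine ((does_move_left_tmp _ f x (c := m.left x - (j + 1)) (by simp; omega)).seq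
      (does_move_arr _ f b (by simpa using by omega))).of_eq rfl le_rfl ?_
    simp
  · ext1 <;> simp [hp, ht]
  · simp

/-- Return to the beginning of the array `b`. -/
def unseekArr (b : Bool) (x : Fin r) : Program r :=
  whileNonempty tmp ((move tmp (left x)).seq (move (arr' b) (arr b)))

theorem does_unseekArr (hx : m.left x = 0) (ht : m.tmp = i) (hp : m.apos b = i)
    (hi : i ≤ (m.val b).length) :
    Does (unseekArr b x) f m.toStacks (i * 6 + 2) f
      { m with
        left := Function.update m.left x i
        apos := Function.update m.apos b 0
        tmp := 0 }.toStacks := by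
  subst ht
  refine (does_whileNonempty (T := 4) m.tmp
    (fun j => Memory.toStacks { m with
      left := Function.update m.left x j
      apos := Function.update m.apos b (m.tmp - j)
      tmp := m.tmp - j }) ?_ ?_ ?_).of_eq ?_ le_rfl ?_
  · intro j hj
    simp [Memory.toStacks, Nat.sub_eq_zero_iff_le, hj]
  · simp [Memory.toStacks]
  · intro j hj
    refine ((does_move_tmp_left _ f x (c := m.tmp - (j + 1)) (by simp; omega)).seq
      (does_move_arr' _ f b (p := m.tmp - (j + 1)) (by simp; omega)
        (by simpa using by omega))).of_eq rfl le_rfl ?_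
    simp
  · ext1 <;> simp [hp, hx]
  · simp

/-- Read the current entry of the array `b`. -/
def readArr (b : Bool) : Program r := .peek (arr b) fun v o => { v with flag := o.getD false }

theorem does_readArr (h : m.apos b < (m.val b).length) :
    Does (readArr b) f m.toStacks 1 (m.val b)[m.apos b] m.toStacks := by
  intro v _
  refine ⟨_, ?_, runs_peek _ _ _ _⟩
  simp only [Memory.toStacks, List.head?_drop, List.getElem?_eq_getElem h]
  rfl

/-- Overwrite the current entry of the array `b`. -/
def writeArr (b c : Bool) : Program r :=
  (Prog.pop (arr b) fun v _ => v).seq (.push (arr b) fun _ => c)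

theorem does_writeArr (c : Bool) (h : m.apos b < (m.val b).length) :
    Does (writeArr b c) f m.toStacks 2 f
      { m with val := Function.update m.val b ((m.val b).set (m.apos b) c) }.toStacks := by
  intro v hv
  have hr := (runs_pop (arr b) (fun (v : Control) _ => v) v m.toStacks).seq
    (runs_push (arr b) (fun _ => c) _ _)
  rw [Function.update_idem, Function.update_self] at hr
  have hS : Function.update m.toStacks (arr b) (c :: (m.toStacks (arr b)).tail) =
      { m with val := Function.update m.val b ((m.val b).set (m.apos b) c) }.toStacks := by
    funext k
    by_cases hk : k = arr b
    · subst hk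
      rw [Function.update_self]
      simp only [Memory.toStacks, Function.update_self, List.tail_drop]
      conv_rhs =>
        rw [List.drop_eq_getElem_cons (by simpa using h), List.getElem_set_self, List.drop_set]
      simp
    · rw [Function.update_of_ne hk]
      cases k with
      | arr b' =>
        have : b' ≠ b := by simpa using hk
        simp [Memory.toStacks, Function.update_of_ne this]
      | arr' b' =>
        by_cases hb : b' = b
        · subst hb
          simp [Memory.toStacks, List.take_set_of_le]
        · simp [Memory.toStacks, Function.update_of_ne hb]
      | _ => rfl
  rw [hS] at hr
  exact ⟨v, hv, hr⟩

/-- Test the entry of the array `b` with the index in the register `x`. -/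
def testArr (b : Bool) (x : Fin r) : Program r :=
  (seekArr b x).seq ((readArr b).seq (unseekArr b x))

theorem does_testArr (hx : m.left x = i) (ht : m.tmp = 0) (hp : m.apos b = 0)
    (hi : i < (m.val b).length) :
    Does (testArr b x) f m.toStacks (12 * i + 5) (m.val b)[i] m.toStacks := by
  have h1 := does_seekArr (f := f) hx ht hp hi.le
  have h2 := does_readArr (f := f) (b := b) (m := { m with
        left := Function.update m.left x 0
        apos := Function.update m.apos b i
        tmp := i }) (by simpa using hi)
  have h3 := does_unseekArr (f := (m.val b)[i]) (x := x) (b := b) (i := i) (m := { m with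
        left := Function.update m.left x 0
        apos := Function.update m.apos b i
        tmp := i }) (by simp) (by simp) (by simp) (by simpa using hi.le)
  simp only [Function.update_self] at h2
  refine (h1.seq (h2.seq h3)).of_eq rfl (by omega) ?_
  ext1 <;> simp [hx, ht, hp]

/-- Overwrite the entry of the array `b` with the index in the register `x`. -/
def storeArr (b : Bool) (x : Fin r) (c : Bool) : Program r :=
  (seekArr b x).seq ((writeArr b c).seq (unseekArr b x))

theorem does_storeArr (c : Bool) (hx : m.left x = i) (ht : m.tmp = 0) (hp : m.apos b = 0)
    (hi : i < (m.val b).length) :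
    Does (storeArr b x c) f m.toStacks (12 * i + 6) f
      { m with val := Function.update m.val b ((m.val b).set i c) }.toStacks := by
  have h1 := does_seekArr (f := f) hx ht hp hi.le
  have h2 := does_writeArr (f := f) (b := b) c (m := { m with
        left := Function.update m.left x 0
        apos := Function.update m.apos b i
        tmp := i }) (by simpa using hi)
  have h3 := does_unseekArr (f := f) (x := x) (b := b) (i := i) (m := { m with
        val := Function.update m.val b ((m.val b).set i c)
        left := Function.update m.left x 0
        apos := Function.update m.apos b i
        tmp := i }) (by simp) (by simp) (by simp) (by simpa using hi.le)
  simp only [Function.update_self] at h2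
  refine (h1.seq (h2.seq h3)).of_eq rfl (by omega) ?_
  ext1 <;> simp [hx, ht, hp]

/-- Go to the end of the current row of the input matrix. -/
def skipRow : Program r := scan.seq (whileFlag scan)

/-- The first scan sets the flag, whatever its value before; the loop then reads columns `1` to `n`,
the last being the end marker, which clears the flag. -/
theorem does_skipRow (G : SimpleGraph (Fin n)) (hw : m.word = encodeGraph G) (hi : i < n)
    (hp : m.pos = i * (n + 1)) :
    Does skipRow f m.toStacks (4 * n + 4) false { m with pos := (i + 1) * (n + 1) }.toStacks := by
  obtain ⟨word, pos, val, apos, left, right, tmp⟩ := m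
  dsimp only at hw hp
  subst hw hp
  have hlen := length_encodeGraph G
  have h1 := does_scan ⟨encodeGraph G, i * (n + 1), val, apos, left, right, tmp⟩ f
    (by have := row_add_lt hi (Nat.zero_le n); dsimp only; omega)
  have h2 := isSome_getElem_encodeGraph G hi (Nat.zero_le n)
    (by have := row_add_lt hi (Nat.zero_le n); omega)
  simp only [Nat.add_zero] at h2
  simp only [h2] at h1
  refine (h1.seq (does_whileFlag (T := 3) n (fun j => Memory.toStacks
    ⟨encodeGraph G, i * (n + 1) + 1 + j, val, apos, left, right, tmp⟩) ?_)).of_eq rfl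
      (by omega) ?_
  · intro j hj
    have h4 : i * (n + 1) + (j + 1) < (encodeGraph G).length := by
      rw [hlen]
      exact row_add_lt hi hj
    have h3 := isSome_getElem_encodeGraph G hi (j := j + 1) hj h4
    have h5 : i * (n + 1) + 1 + j = i * (n + 1) + (j + 1) := by omega
    rw [← h3, h5]
    refine (does_scan ⟨encodeGraph G, i * (n + 1) + (j + 1), val, apos, left, right, tmp⟩ true
      h4).of_eq rfl le_rfl ?_
    ext1 <;> simp
    omega
  · ext1 <;> simp
    rw [Nat.succ_mul]
    omega

/-- Go to the beginning of the row of the input matrix with the index in the register `x`. -/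
def seekRow (x : Fin r) : Program r := whileNonempty (left x) ((move (left x) tmp).seq skipRow)

theorem does_seekRow (G : SimpleGraph (Fin n)) (hw : m.word = encodeGraph G) (hp : m.pos = 0)
    (hx : m.left x = i) (hi : i ≤ n) (ht : m.tmp = 0) :
    Does (seekRow x) false m.toStacks (i * (4 * n + 8) + 2) false
      { m with
        pos := i * (n + 1)
        left := Function.update m.left x 0
        tmp := i }.toStacks := by
  subst hx
  refine (does_whileNonempty (T := 4 * n + 6) (m.left x)
    (fun j => Memory.toStacks { m with
      pos := j * (n + 1)
      left := Function.update m.left x (m.left x - j)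
      tmp := j }) ?_ ?_ ?_).of_eq ?_ le_rfl ?_
  · intro j hj
    simp [Memory.toStacks, Nat.sub_eq_zero_iff_le, hj]
  · simp [Memory.toStacks]
  · intro j hj
    have h1 := does_move_left_tmp { m with
      pos := j * (n + 1)
      left := Function.update m.left x (m.left x - j)
      tmp := j } false x (c := m.left x - (j + 1)) (by simp; omega)
    refine (h1.seq (does_skipRow G (i := j) hw (by omega) rfl)).of_eq rfl (by omega) ?_
    simp
  · ext1 <;> simp [hp, ht]
  · simp

/-- Go `c` symbols to the right in the input word, where `c` is the number in the register `x`. -/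
def seekCell (x : Fin r) : Program r :=
  whileNonempty (left x) ((move (left x) tmp).seq (move inp inp'))

theorem does_seekCell (hx : m.left x = i) (hi : m.pos + i ≤ m.word.length) (ht : m.tmp = 0) :
    Does (seekCell x) f m.toStacks (i * 6 + 2) f
      { m with
        pos := m.pos + i
        left := Function.update m.left x 0
        tmp := i }.toStacks := by
  subst hx
  refine (does_whileNonempty (T := 4) (m.left x)
    (fun j => Memory.toStacks { m with
      pos := m.pos + j
      left := Function.update m.left x (m.left x - j)
      tmp := j }) ?_ ?_ ?_).of_eq ?_ le_rfl ?_
  · intro j hj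
    simp [Memory.toStacks, Nat.sub_eq_zero_iff_le, hj]
  · simp [Memory.toStacks]
  · intro j hj
    refine ((does_move_left_tmp _ f x (c := m.left x - (j + 1)) (by simp; omega)).seq
      (does_move_inp _ f (by simpa using by omega))).of_eq rfl le_rfl ?_
    simp [Nat.add_assoc]
  · ext1 <;> simp [ht]
  · simp

/-- Move the contents of `tmp` back to the register `x`. -/
def restore (x : Fin r) : Program r := whileNonempty tmp (move tmp (left x))

theorem does_restore (hx : m.left x = 0) (ht : m.tmp = i) :
    Does (restore x) f m.toStacks (i * 4 + 2) f
      { m with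
        left := Function.update m.left x i
        tmp := 0 }.toStacks := by
  subst ht
  refine (does_whileNonempty (T := 2) m.tmp
    (fun j => Memory.toStacks { m with
      left := Function.update m.left x j
      tmp := m.tmp - j }) ?_ ?_ ?_).of_eq ?_ le_rfl ?_
  · intro j hj
    simp [Memory.toStacks, Nat.sub_eq_zero_iff_le, hj]
  · simp [Memory.toStacks]
  · intro j hj
    refine (does_move_tmp_left _ f x (c := m.tmp - (j + 1)) (by simp; omega)).of_eq rfl le_rfl ?_
    simp
  · ext1 <;> simp [hx]
  · simp

/-- Return to the beginning of the input word. -/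
def rewind : Program r := whileNonempty inp' (move inp' inp)

theorem does_rewind (hp : m.pos ≤ m.word.length) :
    Does rewind f m.toStacks (m.pos * 4 + 2) f { m with pos := 0 }.toStacks := by
  refine (does_whileNonempty (T := 2) m.pos
    (fun j => Memory.toStacks { m with pos := m.pos - j }) ?_ ?_ ?_).of_eq ?_ le_rfl ?_
  · intro j hj
    rw [← List.length_pos_iff]
    simp [Memory.toStacks]
    omega
  · simp [Memory.toStacks]
  · intro j hj
    exact (does_move_inp' _ f (p := m.pos - (j + 1)) (by simp; omega) (by simp; omega))
  · simp
  · simp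

/-- Test whether the current symbol of the input word is `some true`. -/
def readInp : Program r := .peek inp fun v o => { v with flag := o.join.getD false }

theorem does_readInp {c : Bool} (h : m.word[m.pos]? = some (some c)) :
    Does readInp f m.toStacks 1 c m.toStacks := by
  intro v _
  refine ⟨_, ?_, runs_peek _ _ _ _⟩
  simp only [Memory.toStacks, List.head?_drop, h]
  rfl

/-- Test whether the vertices in the registers `x` and `y` are adjacent. -/
def testAdj (x y : Fin r) : Program r :=
  (setFlag false).seq ((seekRow x).seq ((restore x).seq ((seekCell y).seq (readInp.seq
    ((restore y).seq rewind)))))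

-- The register `x` is restored before `y` is consulted, so `x` and `y` may be the same register.
open Classical in
theorem does_testAdj (G : SimpleGraph (Fin n)) (hw : m.word = encodeGraph G) (hp : m.pos = 0)
    (ht : m.tmp = 0) (i j : Fin n) (hi : m.left x = i) (hj : m.left y = j) :
    Does (testAdj x y) f m.toStacks (8 * n * n + 26 * n + 12) (decide (G.Adj i j)) m.toStacks := by
  have hlt : (i : ℕ) * (n + 1) + j < (encodeGraph G).length := by
    rw [length_encodeGraph]
    exact row_add_lt i.2 j.2.le
  have hx : Function.update m.left x (i : ℕ) = m.left := by simp [hi]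
  have hy : Function.update m.left y (j : ℕ) = m.left := by simp [hj]
  have hT1 : (i : ℕ) * (4 * n + 8) ≤ n * (4 * n + 8) := Nat.mul_le_mul_right _ i.2.le
  have hT2 : (i : ℕ) * (n + 1) ≤ n * (n + 1) := Nat.mul_le_mul_right _ i.2.le
  have h0 := does_setFlag f false m.toStacks
  have h1 := does_seekRow G hw hp hi i.2.le ht
  have h2 := does_restore (f := false) (x := x) (i := i) (m := { m with
      pos := (i : ℕ) * (n + 1)
      left := Function.update m.left x 0
      tmp := (i : ℕ) }) (by simp) rfl
  simp only [Function.update_idem, hx] at h2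
  have h3 := does_seekCell (f := false) (x := y) (i := j) (m := { m with
      pos := (i : ℕ) * (n + 1)
      tmp := 0 }) hj (by rw [hw]; exact hlt.le) rfl
  have h4 := does_readInp (f := false) (c := decide (G.Adj i j)) (m := { m with
      pos := (i : ℕ) * (n + 1) + j
      left := Function.update m.left y 0
      tmp := (j : ℕ) }) (by simp [hw, getElem?_encodeGraph G i j.2.le])
  have h5 := does_restore (f := decide (G.Adj i j)) (x := y) (i := j) (m := { m with
      pos := (i : ℕ) * (n + 1) + j
      left := Function.update m.left y 0
      tmp := (j : ℕ) }) (by simp) rfl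
  simp only [Function.update_idem, hy] at h5
  have h6 := does_rewind (f := decide (G.Adj i j)) (m := { m with
      pos := (i : ℕ) * (n + 1) + j
      tmp := 0 }) (by rw [hw]; exact hlt.le)
  refine (h0.seq (h1.seq (h2.seq (h3.seq (h4.seq (h5.seq h6)))))).of_eq rfl ?_ ?_
  · have := i.2
    have := j.2
    dsimp only
    nlinarith
  · ext1 <;> simp [hp, ht]

end Program

/-! ### Characteristic vectors and the resting state of the memory -/

section EncodeSet

variable {n : ℕ} (S : Finset (Fin n))

theorem length_encodeSet : (encodeSet S).length = n := by
  simp [encodeSet]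

theorem getElem_encodeSet (i : Fin n) (h : (i : ℕ) < (encodeSet S).length) :
    (encodeSet S)[(i : ℕ)] = decide (i ∈ S) := by
  simp [encodeSet]

theorem encodeSet_set_true (i : Fin n) : (encodeSet S).set i true = encodeSet (insert i S) := by
  apply List.ext_getElem
  · simp [encodeSet]
  · intro j h1 h2
    simp [encodeSet, List.getElem_set, Fin.ext_iff, eq_comm (a := j)]

theorem encodeSet_set_false (i : Fin n) : (encodeSet S).set i false = encodeSet (S.erase i) := by
  apply List.ext_getElem
  · simp [encodeSet]
  · intro j h1 h2
    simp [encodeSet, List.getElem_set, Fin.ext_iff, eq_comm (a := j)]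

end EncodeSet

/-- The memory between two operations: `S` is stored in the output array, and the register `i`
holds the number `l i`. -/
noncomputable def Memory.ready {r n : ℕ} (G : SimpleGraph (Fin n)) (S : Finset (Fin n))
    (l : Fin r → ℕ) : Memory r where
  word := encodeGraph G
  pos := 0
  val := fun b => encodeSet (if b then S else ∅)
  apos := fun _ => 0
  left := l
  right := fun i => n - l i
  tmp := 0

/-! ### Evaluating first-order formulas -/

/-- First-order formulas about a graph and a set of its vertices, with the registers as
variables. -/
inductive Query (r : ℕ) : Type
  | adj (x y : Fin r)
  | mem (x : Fin r)
  | eq (x y : Fin r)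
  | not (φ : Query r)
  | and (φ ψ : Query r)
  | ex (x : Fin r) (φ : Query r)

namespace Query

variable {r n : ℕ}

/-- Satisfaction of a formula. -/
def Holds (G : SimpleGraph (Fin n)) (S : Finset (Fin n)) : Query r → (Fin r → Fin n) → Prop
  | adj x y, e => G.Adj (e x) (e y)
  | mem x, e => e x ∈ S
  | eq x y, e => e x = e y
  | not φ, e => ¬ φ.Holds G S e
  | and φ ψ, e => φ.Holds G S e ∧ ψ.Holds G S e
  | ex x φ, e => ∃ i, φ.Holds G S (Function.update e x i)

/-- The bound variables of a formula. -/
def bound : Query r → List (Fin r)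
  | adj _ _ => []
  | mem _ => []
  | eq _ _ => []
  | not φ => φ.bound
  | and φ ψ => φ.bound ++ ψ.bound
  | ex x φ => x :: φ.bound

/-- No variable is bound in the scope of a quantifier of the same variable. -/
def WellScoped : Query r → Prop
  | adj _ _ => True
  | mem _ => True
  | eq _ _ => True
  | not φ => φ.WellScoped
  | and φ ψ => φ.WellScoped ∧ ψ.WellScoped
  | ex x φ => x ∉ φ.bound ∧ φ.WellScoped

end Query

namespace Program

open Stack Prog

variable {r n : ℕ}

/-- Test whether the registers `x` and `y` hold the same number. -/
def testEq (x y : Fin r) : Program r :=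
  (storeArr false x true).seq ((testArr false y).seq (storeArr false x false))

/-- Negate the flag. -/
def flip : Program r := .load fun v => { v with flag := !v.flag }

theorem does_flip (f : Bool) (S : ∀ k : Stack r, List k.Alphabet) : Does flip f S 1 (!f) S := by
  rintro v rfl
  exact ⟨_, rfl, runs_load _ _ _⟩

/-- Set the register `x` to zero. -/
def reset (x : Fin r) : Program r := whileNonempty (left x) (move (left x) (right x))

/-- Test whether `p` succeeds for some value of the register `x`. -/
def testExists (x : Fin r) (p : Program r) : Program r :=
  (setFlag false).seq ((check (right x)).seq ((Prog.loop (fun v => v.more && !v.flag)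
    (p.seq ((move (right x) (left x)).seq (check (right x))))).seq (reset x)))

/-- Run `p` for all the values of the register `x`, in increasing order. -/
def forAll (x : Fin r) (p : Program r) : Program r :=
  (whileNonempty (right x) (p.seq (move (right x) (left x)))).seq (reset x)

theorem update_right (l : Fin r → ℕ) (x : Fin r) (j : ℕ) :
    (fun i => n - Function.update l x j i) = Function.update (fun i => n - l i) x (n - j) := by
  funext i
  by_cases h : i = x
  · subst h; simp
  · simp [h]

variable (G : SimpleGraph (Fin n)) (S : Finset (Fin n)) {l : Fin r → ℕ} {f : Bool} {T : ℕ}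

/-- The array `arr false` is empty between operations: the index `i` is marked in it, the entry `j`
is read, and the mark is erased. -/
theorem does_testEq (x y : Fin r) {i j : Fin n} (hx : l x = i) (hy : l y = j) :
    Does (testEq x y) f (Memory.ready G S l).toStacks (36 * n + 17) (decide (i = j))
      (Memory.ready G S l).toStacks := by
  have h1 := does_storeArr (f := f) (m := Memory.ready G S l) (b := false) (x := x) (i := i) true
    hx rfl rfl (by simp [Memory.ready, length_encodeSet])
  have h2 := does_testArr (f := f) (x := y) (b := false) (i := j) (m := { Memory.ready G S l with
      val := Function.update (Memory.ready G S l).val false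
        (((Memory.ready G S l).val false).set i true) })
    hy rfl rfl (by simp [Memory.ready, length_encodeSet])
  have h3 := does_storeArr (f := decide (i = j)) (x := x) (b := false) (i := i)
    (m := { Memory.ready G S l with
      val := Function.update (Memory.ready G S l).val false
        (((Memory.ready G S l).val false).set i true) }) false
    hx rfl rfl (by simp [Memory.ready, length_encodeSet])
  have hb : (if (i : ℕ) = (j : ℕ) then true else
      (encodeSet (∅ : Finset (Fin n)))[(j : ℕ)]'(by simp [length_encodeSet])) =
        decide (i = j) := by
    rw [getElem_encodeSet]
    simp [Fin.ext_iff]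
  simp only [Memory.ready, Function.update_self, List.getElem_set, Bool.false_eq_true,
    if_false, hb] at h2
  refine (h1.seq (h2.seq h3)).of_eq rfl (by have := i.2; have := j.2; omega) ?_
  ext1 <;> try rfl
  funext b
  cases b
  · simp [Memory.ready, encodeSet_set_true, encodeSet_set_false]
  · simp [Memory.ready]

theorem does_store (x : Fin r) {i : Fin n} (hx : l x = i) :
    Does (storeArr true x true) f (Memory.ready G S l).toStacks (12 * n + 6) f
      (Memory.ready G (insert i S) l).toStacks := by
  refine (does_storeArr (f := f) (m := Memory.ready G S l) (b := true) (x := x) (i := i) true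
    hx rfl rfl (by simp [Memory.ready, length_encodeSet])).of_eq rfl
      (by have := i.2; omega) ?_
  ext1 <;> try rfl
  funext b
  cases b
  · simp [Memory.ready]
  · simp [Memory.ready, encodeSet_set_true]

theorem does_reset {x : Fin r} {j : ℕ} (hj : j ≤ n) :
    Does (reset x) f (Memory.ready G S (Function.update l x j)).toStacks (j * 4 + 2) f
      (Memory.ready G S (Function.update l x 0)).toStacks := by
  refine (does_whileNonempty (T := 2) j
    (fun k => Memory.toStacks (Memory.ready G S (Function.update l x (j - k)))) ?_ ?_ ?_).of_eq
      ?_ le_rfl ?_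
  · intro k hk
    simp [Memory.toStacks, Memory.ready, Nat.sub_eq_zero_iff_le, hk]
  · simp [Memory.toStacks, Memory.ready]
  · intro k hk
    refine (does_move_left_right _ f x (c := j - (k + 1))
      (by simp [Memory.ready]; omega)).of_eq rfl le_rfl ?_
    ext1 <;> try rfl
    · simp [Memory.ready]
    · simp only [Memory.ready, update_right, Function.update_idem, Function.update_self]
      congr 1
      omega
  · simp
  · simp

theorem does_advance {x : Fin r} {j : ℕ} (hj : j < n) :
    Does (move (right x) (left x)) f (Memory.ready G S (Function.update l x j)).toStacks 2 f
      (Memory.ready G S (Function.update l x (j + 1))).toStacks := by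
  refine (does_move_right_left _ f x (c := n - (j + 1)) (by simp [Memory.ready]; omega)).of_eq
    rfl le_rfl ?_
  ext1 <;> try rfl
  · simp [Memory.ready]
  · simp only [Memory.ready, update_right, Function.update_idem]

theorem Does.flag_eq {p : Program r} {f f₁ f₂ : Bool} {S S' : ∀ k : Stack r, List k.Alphabet}
    (h : Does p f S T f₁ S') (hf : f₁ = f₂) : Does p f S T f₂ S' :=
  hf ▸ h

-- The search stops after the round that finds a witness, so the value `j'` left in the register is
-- not determined by the statement. Resetting the register to zero restores the memory.
open Classical in
theorem does_testExists {x : Fin r} {p : Program r} (hx : l x = 0) (P : ℕ → Prop)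
    (hp : ∀ j < n, ∀ f, Does p f (Memory.ready G S (Function.update l x j)).toStacks T
      (decide (P j)) (Memory.ready G S (Function.update l x j)).toStacks) :
    Does (testExists x p) f (Memory.ready G S l).toStacks (n * (T + 8) + 5)
      (decide (∃ j < n, P j)) (Memory.ready G S l).toStacks := by
  -- Here `d` counts the values still to be tried. A round costs the body, a move, a check and the
  -- loop test.
  have key : ∀ d j, j + d = n → ∀ v : Control, v.flag = false → v.more = decide (j < n) →
      ∃ v' : Control, ∃ j' ≤ n, v'.flag = decide (∃ k, j ≤ k ∧ k < n ∧ P k) ∧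
        (Prog.loop (fun v : Control => v.more && !v.flag)
          (p.seq ((move (right x) (left x)).seq (check (right x))))).Runs
          (v, (Memory.ready G S (Function.update l x j)).toStacks) (d * (T + 4) + 1)
          (v', (Memory.ready G S (Function.update l x j')).toStacks) := by
    intro d
    induction d with
    | zero =>
      intro j hj v hv hm
      refine ⟨v, j, by omega, ?_, 1, by omega, .loop_false ?_⟩
      · rw [hv, eq_comm, decide_eq_false_iff_not]
        rintro ⟨k, h1, h2, -⟩
        omega
      · simp only [hm, Bool.and_eq_false_iff, decide_eq_false_iff_not]
        exact .inl (by omega)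
    | succ d ih =>
      intro j hj v hv hm
      obtain ⟨v₁, hv₁, t₁, ht₁, hr₁⟩ := hp j (by omega) false v hv
      obtain ⟨v₂, hv₂, t₂, ht₂, hr₂⟩ := does_advance (x := x) (l := l) (f := decide (P j))
        G S (show j < n by omega) v₁ hv₁
      obtain ⟨t₃, ht₃, hr₃⟩ := runs_check (right x) v₂
        (Memory.ready G S (Function.update l x (j + 1))).toStacks
      have hm₃ : (((Memory.ready G S (Function.update l x (j + 1))).toStacks
          (right x)).head?.isSome) = decide (j + 1 < n) := by
        simp only [Memory.toStacks, Memory.ready, Function.update_self, List.head?_replicate]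
        by_cases h : j + 1 < n
        · rw [if_neg (by omega)]
          simp [h]
        · rw [if_pos (by omega)]
          simp [h]
      rw [hm₃] at hr₃
      have hc : (v.more && !v.flag) = true := by
        simp [hv, hm]
        omega
      have hbody := hr₁.seq (hr₂.seq hr₃)
      by_cases hP : P j
      · refine ⟨_, j + 1, by omega, ?_, _, ?_, .loop_true hc hbody (.loop_false ?_)⟩
        · dsimp only
          rw [hv₂, decide_eq_true hP, eq_comm, decide_eq_true_iff]
          exact ⟨j, le_rfl, by omega, hP⟩
        · rw [Nat.succ_mul]
          omega
        · simp [hv₂, hP]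
      · obtain ⟨v', j', hj', hv', t', ht', hr'⟩ := ih (j + 1) (by omega)
          { v₂ with more := decide (j + 1 < n) } (by simp [hv₂, hP]) rfl
        refine ⟨v', j', hj', ?_, _, ?_, .loop_true hc hbody hr'⟩
        · rw [hv', decide_eq_decide]
          constructor
          · rintro ⟨k, h1, h2⟩
            exact ⟨k, by omega, h2⟩
          · rintro ⟨k, h1, h2, h3⟩
            refine ⟨k, ?_, h2, h3⟩
            rcases h1.eq_or_lt with rfl | h
            · exact absurd h3 hP
            · exact h
        · rw [Nat.succ_mul]
          omega
  intro v hv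
  have hl : Function.update l x 0 = l := by rw [← hx, Function.update_eq_self]
  obtain ⟨v₁, hv₁, hr₁⟩ := does_setFlag f false (Memory.ready G S l).toStacks v hv
  have hr₂ := runs_check (right x) v₁ (Memory.ready G S l).toStacks
  obtain ⟨v₃, j, hj, hv₃, hr₃⟩ := key n 0 (by simp)
    { v₁ with more := ((Memory.ready G S l).toStacks (right x)).head?.isSome } hv₁ (by
      simp only [Memory.toStacks, Memory.ready, hx, Nat.sub_zero, List.head?_replicate]
      by_cases h : 0 < n
      · rw [if_neg (by omega)]
        simp [h]
      · rw [if_pos (by omega)]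
        simp [h])
  rw [hl] at hr₃
  obtain ⟨v₄, hv₄, hr₄⟩ := does_reset (x := x) (l := l) G S hj v₃ rfl
  rw [hl] at hr₄
  refine ⟨v₄, ?_, (hr₁.seq (hr₂.seq (hr₃.seq hr₄))).mono ?_⟩
  · rw [hv₄, hv₃]
    simp
  · rw [Nat.mul_add, Nat.mul_add]
    omega

theorem does_forAll {x : Fin r} {p : Program r} (hx : l x = 0) (A : ℕ → Finset (Fin n))
    (hp : ∀ j < n, Does p f (Memory.ready G (A j) (Function.update l x j)).toStacks T f
      (Memory.ready G (A (j + 1)) (Function.update l x j)).toStacks) :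
    Does (forAll x p) f (Memory.ready G (A 0) l).toStacks (n * (T + 8) + 4) f
      (Memory.ready G (A n) l).toStacks := by
  have hl : Function.update l x 0 = l := by rw [← hx, Function.update_eq_self]
  have h1 := does_whileNonempty (f := f) (k := right x) (T := T + 2)
    (p := p.seq (move (right x) (left x))) n
    (fun j => Memory.toStacks (Memory.ready G (A j) (Function.update l x j))) ?_ ?_ ?_
  · have h2 := does_reset (x := x) (l := l) (f := f) G (A n) le_rfl
    rw [hl] at h1 h2
    refine (h1.seq h2).mono ?_
    rw [Nat.mul_add, Nat.mul_add, Nat.mul_add]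
    omega
  · intro j hj
    simp [Memory.toStacks, Memory.ready, Nat.sub_eq_zero_iff_le, hj]
  · simp [Memory.toStacks, Memory.ready]
  · intro j hj
    exact (hp j hj).seq (does_advance G (A (j + 1)) hj)

end Program

namespace Query

open Program

variable {r n : ℕ}

/-- A program that evaluates a formula. -/
def program : Query r → Program r
  | adj x y => testAdj x y
  | mem x => testArr true x
  | eq x y => testEq x y
  | not φ => φ.program.seq Program.flip
  | and φ ψ => φ.program.seq (ifFlag ψ.program (setFlag false))
  | ex x φ => testExists x φ.program

/-- A bound for the running time of the evaluation of a formula. -/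
noncomputable def time : Query r → Polynomial ℕ
  | adj _ _ => 8 * .X * .X + 26 * .X + 12
  | mem _ => 12 * .X + 5
  | eq _ _ => 36 * .X + 17
  | not φ => φ.time + 1
  | and φ ψ => φ.time + (1 + (ψ.time + 1))
  | ex _ φ => .X * (φ.time + 8) + 5

-- A quantifier counts its register up from zero, so bound registers must start at zero. Inside its
-- scope the register is in use, hence no variable may be rebound there; disjoint scopes may share a
-- register, which is reset in between.
open Classical in
theorem does_program (G : SimpleGraph (Fin n)) (S : Finset (Fin n)) (φ : Query r) :
    ∀ (e : Fin r → Fin n) (f : Bool), φ.WellScoped → (∀ x ∈ φ.bound, (e x : ℕ) = 0) →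
      Does φ.program f (Memory.ready G S fun i => (e i : ℕ)).toStacks (φ.time.eval n)
        (decide (φ.Holds G S e)) (Memory.ready G S fun i => (e i : ℕ)).toStacks := by
  induction φ with
  | adj x y =>
    intro e f _ _
    refine (does_testAdj G rfl rfl rfl (e x) (e y) rfl rfl).mono ?_
    simp [time]
  | mem x =>
    intro e f _ _
    have h := does_testArr (f := f) (b := true) (x := x) (i := e x)
      (m := Memory.ready G S fun i => (e i : ℕ)) rfl rfl rfl
      (by simp [Memory.ready, length_encodeSet])
    refine (h.mono ?_).flag_eq ?_
    · have := (e x).2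
      simp [time]
    · simp only [Memory.ready, if_true]
      rw [getElem_encodeSet]
      exact decide_eq_decide.2 Iff.rfl
  | eq x y =>
    intro e f _ _
    refine ((does_testEq G S x y (l := fun i => (e i : ℕ)) (i := e x) (j := e y) rfl rfl).mono
      ?_).flag_eq (decide_eq_decide.2 Iff.rfl)
    simp [time]
  | not φ ih =>
    intro e f hw hb
    refine (((ih e f hw hb).seq (does_flip _ _)).mono (by simp [time])).flag_eq ?_
    by_cases h : φ.Holds G S e <;> simp [Holds, h]
  | and φ ψ ih₁ ih₂ =>
    intro e f hw hb
    simp only [bound, List.mem_append] at hb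
    have h1 := ih₁ e f hw.1 fun x hx => hb x (.inl hx)
    refine Does.mono (h1.seq (T₂ := 1 + (ψ.time.eval n + 1)) ?_) (by simp [time])
    by_cases h : φ.Holds G S e
    · simp only [h, decide_true, Holds, true_and]
      exact does_ifFlag_true ((ih₂ e true hw.2 fun x hx => hb x (.inr hx)).mono (by omega))
    · simp only [h, decide_false, Holds, false_and]
      exact does_ifFlag_false ((does_setFlag false false _).mono (by omega))
  | ex x φ ih =>
    intro e f hw hb
    simp only [bound, List.mem_cons, forall_eq_or_imp] at hb
    refine Does.mono (T₁ := n * (φ.time.eval n + 8) + 5) ?_ (by simp [time])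
    refine (does_testExists (f := f) (T := φ.time.eval n) (p := φ.program) G S (x := x)
      (l := fun i => (e i : ℕ)) hb.1
      -- The search runs over natural numbers, so the bound `j < n` is made part of the predicate.
      (fun j => ∃ h : j < n, φ.Holds G S (Function.update e x ⟨j, h⟩)) ?_).flag_eq ?_
    · intro j hj f
      have he : Function.update (fun i => (e i : ℕ)) x j =
          fun i => (Function.update e x ⟨j, hj⟩ i : ℕ) := by
        funext i
        by_cases h : i = x
        · subst h; simp
        · simp [h]
      rw [he]
      refine (ih (Function.update e x ⟨j, hj⟩) f hw.2 ?_).flag_eq ?_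
      · intro y hy
        rw [Function.update_of_ne]
        · exact hb.2 y hy
        · rintro rfl
          exact hw.1 hy
      · simp [hj]
    · refine decide_eq_decide.2 ?_
      simp only [Holds, Fin.exists_iff]
      exact exists_congr fun j => ⟨fun ⟨_, h2⟩ => h2, fun ⟨h1, h2⟩ => ⟨h1, h1, h2⟩⟩

end Query

/-! ### The reduction rules as formulas -/

namespace Query

variable {r n : ℕ}

/-- Disjunction. -/
def or (φ ψ : Query r) : Query r := (φ.not.and ψ.not).not

/-- Implication. -/
def imp (φ ψ : Query r) : Query r := (φ.and ψ.not).not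

/-- Universal quantification. -/
def all (x : Fin r) (φ : Query r) : Query r := (ex x φ.not).not

/-- Adjacency in the graph in which the vertices of the set are isolated. -/
def isolatedAdj (x y : Fin r) : Query r := (adj x y).and ((mem x).not.and (mem y).not)

variable {G : SimpleGraph (Fin n)} {S : Finset (Fin n)} {e : Fin r → Fin n}

theorem holds_or {φ ψ : Query r} : (φ.or ψ).Holds G S e ↔ φ.Holds G S e ∨ ψ.Holds G S e := by
  simp only [or, Holds]
  tauto

theorem holds_imp {φ ψ : Query r} : (φ.imp ψ).Holds G S e ↔ (φ.Holds G S e → ψ.Holds G S e) := by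
  simp only [imp, Holds]
  tauto

theorem holds_all {x : Fin r} {φ : Query r} :
    (all x φ).Holds G S e ↔ ∀ i, φ.Holds G S (Function.update e x i) := by
  simp only [all, Holds, not_exists, not_not]

theorem holds_isolatedAdj {x y : Fin r} :
    (isolatedAdj x y).Holds G S e ↔ (isolate G S).Adj (e x) (e y) :=
  Iff.rfl

/-- The formula for `IsInducedP3`. -/
def inducedP3 (x y z : Fin r) : Query r :=
  (isolatedAdj x y).and ((isolatedAdj y z).and ((eq x z).not.and (isolatedAdj x z).not))

theorem holds_inducedP3 {x y z : Fin r} :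
    (inducedP3 x y z).Holds G S e ↔ IsInducedP3 (isolate G S) (e x) (e y) (e z) :=
  Iff.rfl

/-- The formula for `P3Dominated`. -/
def dominated (a v : Fin 8) : Query 8 :=
  all 4 (all 5 (all 6 ((inducedP3 4 5 6).imp (((eq 4 a).or ((eq 5 a).or (eq 6 a))).imp
    ((eq 4 v).or ((eq 5 v).or (eq 6 v)))))))

/-- Variables `4`, `5` and `6` are bound in the formula, so `a` and `v` must differ from them. -/
theorem holds_dominated {a v : Fin 8} {e : Fin 8 → Fin n} (ha : a < 4) (hv : v < 4) :
    (dominated a v).Holds G S e ↔ P3Dominated (isolate G S) (e a) (e v) := by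
  have ha4 : a ≠ 4 := ha.ne
  have ha5 : a ≠ 5 := (ha.trans (by decide)).ne
  have ha6 : a ≠ 6 := (ha.trans (by decide)).ne
  have hv4 : v ≠ 4 := hv.ne
  have hv5 : v ≠ 5 := (hv.trans (by decide)).ne
  have hv6 : v ≠ 6 := (hv.trans (by decide)).ne
  simp [dominated, holds_all, holds_imp, holds_or, holds_inducedP3, Holds, P3Dominated,
    Function.update_of_ne, ha4, ha5, ha6, hv4, hv5, hv6]

/-- The formula for `DominatedEndsRule`. -/
def dominatedEndsRule : Query 8 :=
  ex 1 (ex 2 ((inducedP3 1 0 2).and ((dominated 1 0).and (dominated 2 0))))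

/-- The formula for `PrivateNeighborRule`. -/
def privateNeighborRule : Query 8 :=
  ex 1 (ex 2 ((isolatedAdj 0 1).and ((dominated 1 0).and ((isolatedAdj 0 2).and
    (all 3 (((eq 3 2).or (isolatedAdj 2 3)).imp ((eq 3 0).not.imp
      ((isolatedAdj 0 3).and ((isolatedAdj 1 3).not.and (eq 3 1).not)))))))))

/-- The formula for membership in the block of the third rule. -/
def blockMember (x : Fin 8) : Query 8 :=
  (eq x 0).or ((isolatedAdj 0 x).and (isolatedAdj 1 x))

/-- The formula for `PendantBlockRule`. -/
def pendantBlockRule : Query 8 :=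
  ex 1 ((isolatedAdj 0 1).and (
    (all 2 ((isolatedAdj 0 2).imp (((eq 2 1).or (isolatedAdj 1 2)).imp
      (ex 3 ((inducedP3 0 2 3).and (dominated 3 2)))))).and
    (all 4 (all 5 (all 6 ((inducedP3 4 5 6).imp (((eq 4 1).or ((eq 5 1).or (eq 6 1))).imp
      ((blockMember 4).or ((blockMember 5).or (blockMember 6))))))))))

/-- The formula for `RuleApplies`. -/
def rule : Query 8 := dominatedEndsRule.or (privateNeighborRule.or pendantBlockRule)

theorem holds_dominatedEndsRule {e : Fin 8 → Fin n} :
    dominatedEndsRule.Holds G S e ↔ DominatedEndsRule (isolate G S) (e 0) := by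
  simp [dominatedEndsRule, DominatedEndsRule, Holds, holds_inducedP3, holds_dominated,
    Function.update_of_ne]

theorem holds_privateNeighborRule {e : Fin 8 → Fin n} :
    privateNeighborRule.Holds G S e ↔ PrivateNeighborRule (isolate G S) (e 0) := by
  simp [privateNeighborRule, PrivateNeighborRule, Holds, holds_all, holds_imp, holds_or,
    holds_isolatedAdj, holds_dominated, Function.update_of_ne]

theorem holds_pendantBlockRule {e : Fin 8 → Fin n} :
    pendantBlockRule.Holds G S e ↔ PendantBlockRule (isolate G S) (e 0) := by
  simp [pendantBlockRule, PendantBlockRule, blockMember, Holds, holds_all, holds_imp, holds_or,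
    holds_isolatedAdj, holds_inducedP3, holds_dominated, Function.update_of_ne]

theorem holds_rule {e : Fin 8 → Fin n} : rule.Holds G S e ↔ RuleApplies (isolate G S) (e 0) := by
  rw [rule, holds_or, holds_or, holds_dominatedEndsRule, holds_privateNeighborRule,
    holds_pendantBlockRule, RuleApplies]

theorem wellScoped_rule : rule.WellScoped := by
  simp [rule, dominatedEndsRule, privateNeighborRule, pendantBlockRule, blockMember, dominated,
    inducedP3, isolatedAdj, all, imp, or, WellScoped, bound]

/-- Register `0` holds the vertex under test and register `7` counts the passes; evaluating the rule
must leave both alone. -/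
theorem bound_rule {x : Fin 8} (hx : x ∈ rule.bound) : x ≠ 0 ∧ x ≠ 7 := by
  have h : ∀ x ∈ rule.bound, x ≠ 0 ∧ x ≠ 7 := by decide
  exact h x hx

end Query

/-! ### The greedy algorithm -/

section Greedy

variable {n : ℕ} (G : SimpleGraph (Fin n))

open Classical in
/-- Add the vertex `i` to `S` if a reduction rule selects it. -/
noncomputable def greedyStep (S : Finset (Fin n)) (i : ℕ) : Finset (Fin n) :=
  if h : i < n then
    if RuleApplies (isolate G S) ⟨i, h⟩ then insert ⟨i, h⟩ S else S
  else S

/-- Treat the vertices less than `j` in turn. -/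
noncomputable def greedyPass (S : Finset (Fin n)) : ℕ → Finset (Fin n)
  | 0 => S
  | j + 1 => greedyStep G (greedyPass S j) j

/-- The result of `j` passes. -/
noncomputable def greedySet : ℕ → Finset (Fin n)
  | 0 => ∅
  | j + 1 => greedyPass G (greedySet j) n

variable {G}

theorem subset_greedyStep (S : Finset (Fin n)) (i : ℕ) : S ⊆ greedyStep G S i := by
  unfold greedyStep
  split_ifs
  · exact Finset.subset_insert _ _
  · exact subset_rfl
  · exact subset_rfl

theorem IsExtendable.greedyStep {S : Finset (Fin n)} (h : IsExtendable G S) (i : ℕ) :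
    IsExtendable G (greedyStep G S i) := by
  unfold VertexDeletion.greedyStep
  split_ifs with h1 h2
  · convert h.insert h2
  · exact h
  · exact h

theorem greedyPass_mono (S : Finset (Fin n)) : Monotone (greedyPass G S) :=
  monotone_nat_of_le_succ fun j => subset_greedyStep (greedyPass G S j) j

theorem IsExtendable.greedyPass {S : Finset (Fin n)} (h : IsExtendable G S) (j : ℕ) :
    IsExtendable G (greedyPass G S j) := by
  induction j with
  | zero => exact h
  | succ j ih => exact ih.greedyStep j

theorem isExtendable_greedySet (j : ℕ) : IsExtendable G (greedySet G j) := by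
  induction j with
  | zero => exact fun T hT => ⟨T, hT, Finset.empty_subset T, le_rfl⟩
  | succ j ih => exact ih.greedyPass n

/-- If a pass added nothing, each vertex would have been tested against `S` itself, including one
that a rule selects. That vertex is not isolated, hence not in `S`, and would have been added. -/
theorem ssubset_greedyPass (hG : HasCliqueBranches G) {S : Finset (Fin n)} (hS : ¬ HitsP3 G S) :
    S ⊂ greedyPass G S n := by
  refine Finset.ssubset_iff_subset_ne.2 ⟨greedyPass_mono S (Nat.zero_le n), fun heq => ?_⟩
  obtain ⟨v, hv⟩ := exists_ruleApplies_of_not_hitsP3 hG hS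
  have hfix : ∀ j ≤ n, greedyPass G S j = S := by
    intro j hj
    refine le_antisymm ?_ (greedyPass_mono S (Nat.zero_le j))
    conv_rhs => rw [heq]
    exact greedyPass_mono S hj
  have h1 := hfix (v + 1) v.2
  rw [greedyPass, hfix v v.2.le, greedyStep, dif_pos v.2, if_pos hv] at h1
  exact hv.notMem (h1 ▸ Finset.mem_insert_self _ _)

theorem HitsP3.mono {S T : Finset (Fin n)} (h : HitsP3 G S) (hST : S ⊆ T) : HitsP3 G T :=
  fun x y z hp => (h x y z hp).imp (fun h => hST h) (Or.imp (fun h => hST h) fun h => hST h)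

/-- Every pass that starts with a surviving induced path adds a vertex; after `n` such passes all
vertices have been chosen. -/
theorem hitsP3_greedySet (hG : HasCliqueBranches G) : HitsP3 G (greedySet G n) := by
  have key : ∀ j, HitsP3 G (greedySet G j) ∨ j ≤ (greedySet G j).card := by
    intro j
    induction j with
    | zero => exact .inr (Nat.zero_le _)
    | succ j ih =>
      by_cases h : HitsP3 G (greedySet G j)
      · exact .inl (h.mono (greedyPass_mono _ (Nat.zero_le n)))
      · exact .inr ((ih.resolve_left h).trans_lt (Finset.card_lt_card (ssubset_greedyPass hG h)))
  rcases key n with h | h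
  · exact h
  · have : greedySet G n = Finset.univ := by
      rw [← Finset.card_eq_iff_eq_univ, Fintype.card_fin]
      exact le_antisymm (card_finset_fin_le _) h
    intro x y z _
    simp [this]

/-- Any competitor can be exchanged, without growing, for a set that includes the greedy set. -/
theorem isMinimumDeletionSet_greedySet (hG : IsBlockGraph G) :
    IsMinimumDeletionSet cluster G (greedySet G n) := by
  refine ⟨(isClusterGraph_induce_compl_iff _).2 (hitsP3_greedySet hG.hasCliqueBranches), ?_⟩
  intro T hT
  obtain ⟨T', -, h1, h2⟩ := isExtendable_greedySet (G := G) n T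
    ((isClusterGraph_induce_compl_iff T).1 hT)
  exact (Finset.card_le_card h1).trans h2

end Greedy

/-! ### Initialisation, cleaning up and the main program -/

namespace Program

open Stack Prog

variable {r n : ℕ}

/-- Push a symbol on the stacks `right i` for the registers `i` of a list. -/
def pushRight : List (Fin r) → Program r
  | [] => setFlag false
  | i :: L => (Prog.push (right i) fun _ => false).seq (pushRight L)

theorem does_pushRight (L : List (Fin r)) : ∀ (m : Memory r) (f : Bool),
    Does (pushRight L) f m.toStacks (L.length + 1) false
      { m with right := fun i => m.right i + L.count i }.toStacks := by
  induction L with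
  | nil => exact fun m f => (does_setFlag f false _).of_eq rfl (by simp) (by ext1 <;> simp)
  | cons i L ih =>
    intro m f
    have hr : Does (Prog.push (right i) fun _ => false) f m.toStacks 1 f
        { m with right := Function.update m.right i (m.right i + 1) }.toStacks := by
      intro v hv
      have hS : Function.update m.toStacks (right i) (false :: m.toStacks (right i)) =
          { m with right := Function.update m.right i (m.right i + 1) }.toStacks := by
        funext k
        by_cases hk : k = right i
        · subst hk
          simp [Memory.toStacks, List.replicate_succ]
        · rw [Function.update_of_ne hk]
          cases k with
          | right j =>
            have : j ≠ i := by simpa using hk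
            simp [Memory.toStacks, Function.update_of_ne this]
          | _ => rfl
      rw [← hS]
      exact ⟨v, hv, runs_push _ _ _ _⟩
    refine (hr.seq (ih _ f)).of_eq rfl (by rw [List.length_cons]; omega) ?_
    ext1 <;> try rfl
    funext j
    by_cases h : j = i
    · subst h
      simp [Nat.add_assoc, Nat.add_comm]
    · simp [h, List.count_cons_of_ne (Ne.symm h)]

/-- Enlarge the arrays and the range of the registers by one. -/
def newVertex : Program r :=
  (Prog.push (arr true) fun _ => false).seq
    ((Prog.push (arr false) fun _ => false).seq (pushRight (List.finRange r)))

theorem does_push_arr (m : Memory r) (b f : Bool) (hp : m.apos b = 0) :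
    Does (Prog.push (arr b) fun _ => false) f m.toStacks 1 f
      { m with val := Function.update m.val b (false :: m.val b) }.toStacks := by
  intro v hv
  have hS : Function.update m.toStacks (arr b) (false :: m.toStacks (arr b)) =
      { m with val := Function.update m.val b (false :: m.val b) }.toStacks := by
    funext k
    by_cases hk : k = arr b
    · subst hk
      simp [Memory.toStacks, hp]
    · rw [Function.update_of_ne hk]
      cases k with
      | arr c =>
        have : c ≠ b := by simpa using hk
        simp [Memory.toStacks, Function.update_of_ne this]
      | arr' c =>
        by_cases hc : c = b
        · subst hc
          simp [Memory.toStacks, hp]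
        · simp [Memory.toStacks, Function.update_of_ne hc]
      | _ => rfl
  rw [← hS]
  exact ⟨v, hv, runs_push _ _ _ _⟩

/-- Read the input word and set up the arrays and the registers. -/
def setUp : Program r :=
  (setFlag false).seq ((whileNonempty inp (scan.seq (ifFlag (setFlag false) newVertex))).seq rewind)

/-- The memory after reading `p` symbols of the input word. -/
def readMemory (r : ℕ) (n p : ℕ) (w : List (Option Bool)) : Memory r where
  word := w
  pos := p
  val := fun _ => List.replicate (p / (n + 1)) false
  apos := fun _ => 0
  left := fun _ => 0
  right := fun _ => p / (n + 1)
  tmp := 0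

theorem does_newVertex (p : ℕ) (w : List (Option Bool)) (f : Bool)
    (hp : (p + 1) / (n + 1) = p / (n + 1) + 1) :
    Does newVertex f { readMemory r n p w with pos := p + 1 }.toStacks (r + 3) false
      (readMemory r n (p + 1) w).toStacks := by
  refine ((does_push_arr _ true f rfl).seq ((does_push_arr _ false f rfl).seq
    (does_pushRight (List.finRange r) _ f))).of_eq rfl ?_ ?_
  · rw [List.length_finRange]
    omega
  · ext1 <;> try rfl
    · funext b
      cases b <;> simp [readMemory, hp, List.replicate_succ]
    · funext i
      simp [readMemory, hp, List.count_eq_one_of_mem (List.nodup_finRange r)]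

/-- After `p` symbols, `p / (n + 1)` row markers have been read, and each adds one vertex. So `n` is
found in unary by counting markers. -/
theorem does_setUp (G : SimpleGraph (Fin n)) (f : Bool) :
    Does setUp f (readMemory r n 0 (encodeGraph G)).toStacks
      (n * (n + 1) * (r + 13) + 5) false (Memory.ready (r := r) G ∅ fun _ => 0).toStacks := by
  have hlen := length_encodeGraph G
  have h1 := does_setFlag f false (readMemory r n 0 (encodeGraph G)).toStacks
  have h2 := does_whileNonempty (f := false) (k := inp) (T := r + 7)
    (p := scan.seq (ifFlag (setFlag false) newVertex)) (n * (n + 1))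
    (fun p => (readMemory r n p (encodeGraph G)).toStacks) ?_ ?_ ?_
  · have h3 := does_rewind (f := false) (m := readMemory r n (n * (n + 1)) (encodeGraph G)) hlen.ge
    refine (h1.seq (h2.seq h3)).of_eq rfl ?_ ?_
    · simp only [readMemory]
      have h : n * (n + 1) * (r + 13) = n * (n + 1) * (r + 7 + 2) + n * (n + 1) * 4 := by ring
      omega
    · have hdiv : n * (n + 1) / (n + 1) = n := Nat.mul_div_cancel n (Nat.succ_pos n)
      ext1
      · rfl
      · rfl
      · funext b
        cases b <;> simp [Memory.ready, readMemory, hdiv, encodeSet]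
      · rfl
      · rfl
      · funext i
        simp [Memory.ready, readMemory, hdiv]
      · rfl
  · intro p hp
    rw [← List.length_pos_iff]
    simp only [Memory.toStacks, readMemory, List.length_drop]
    omega
  · simp only [Memory.toStacks, readMemory]
    rw [List.drop_eq_nil_iff]
    exact hlen.le
  · intro p hp
    have hi : p / (n + 1) < n := Nat.div_lt_of_lt_mul (by rwa [Nat.mul_comm])
    have hj : p % (n + 1) ≤ n := Nat.le_of_lt_succ (Nat.mod_lt _ (Nat.succ_pos n))
    have hpe : p / (n + 1) * (n + 1) + p % (n + 1) = p := Nat.div_add_mod' p (n + 1)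
    have h3 := isSome_getElem_encodeGraph G hi hj (by omega)
    simp only [hpe] at h3
    have h4 := does_scan (readMemory r n p (encodeGraph G)) false (by simp only [readMemory]; omega)
    simp only [readMemory, h3] at h4
    -- The quotient grows exactly when the column `p % (n + 1)` is `n`, that is, at a marker.
    have hdiv : (p + 1) / (n + 1) = p / (n + 1) + (p % (n + 1) + 1) / (n + 1) := by
      conv_lhs =>
        rw [← hpe, Nat.add_assoc, Nat.add_comm, Nat.add_mul_div_right _ _ (Nat.succ_pos n)]
      exact Nat.add_comm _ _
    by_cases h : p % (n + 1) < n
    · rw [decide_eq_true h] at h4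
      refine (h4.seq (does_ifFlag_true (does_setFlag true false _))).of_eq rfl (by omega) ?_
      rw [Nat.div_eq_of_lt (by omega : p % (n + 1) + 1 < n + 1)] at hdiv
      simp [readMemory, hdiv]
    · rw [decide_eq_false h] at h4
      rw [show p % (n + 1) + 1 = n + 1 by omega, Nat.div_self (Nat.succ_pos n)] at hdiv
      exact (h4.seq (does_ifFlag_false (does_newVertex p _ false hdiv))).mono (by omega)

/-- Remove all symbols from the stack `k`. -/
def clear (k : Stack r) : Program r := whileNonempty k (.pop k fun v _ => v)

theorem does_clear (k : Stack r) (f : Bool) (S : ∀ k : Stack r, List k.Alphabet) :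
    Does (clear k) f S ((S k).length * 3 + 2) f (Function.update S k []) := by
  have h := does_whileNonempty (f := f) (k := k) (T := 1) (p := .pop k fun v _ => v) (S k).length
    (fun j => Function.update S k ((S k).drop j)) ?_ ?_ ?_
  · simpa [clear] using h
  · intro j hj
    simpa using hj
  · simp
  · intro j hj v hv
    refine ⟨v, hv, ?_⟩
    have := runs_pop k (fun (v : Control) _ => v) v (Function.update S k ((S k).drop j))
    rwa [Function.update_idem, Function.update_self, List.tail_drop] at this

/-- Remove all symbols from the stacks of a list. -/
def clearAll : List (Stack r) → Program r
  | [] => setFlag false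
  | k :: L => (clear k).seq (clearAll L)

theorem does_clearAll {N : ℕ} (L : List (Stack r)) : ∀ (S : ∀ k : Stack r, List k.Alphabet)
    (f : Bool), (∀ k, (S k).length ≤ N) →
    Does (clearAll L) f S (L.length * (N * 3 + 2) + 1) false
      fun k => if k ∈ L then [] else S k := by
  induction L with
  | nil =>
    intro S f _
    simpa [clearAll] using does_setFlag f false S
  | cons k L ih =>
    intro S f hS
    have h := (does_clear k f S).seq (ih (Function.update S k []) f fun j => by
      by_cases hj : j = k
      · subst hj; simp
      · rw [Function.update_of_ne hj]; exact hS j)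
    have hfun : (fun j => if j ∈ L then [] else Function.update S k [] j) =
        fun j => if j ∈ k :: L then [] else S j := by
      funext j
      by_cases hj : j = k
      · subst hj; simp
      · simp [hj]
    rw [hfun] at h
    refine h.mono ?_
    have := hS k
    rw [List.length_cons, Nat.succ_mul]
    omega

/-- Add the vertex in register `0` to the output set if a reduction rule selects it. -/
def step : Program 8 :=
  Query.rule.program.seq ((ifFlag (storeArr true 0 true) (setFlag false)).seq (setFlag false))

theorem does_step (G : SimpleGraph (Fin n)) (S : Finset (Fin n)) (i j : Fin n) :
    Does step false
      (Memory.ready G S (Function.update (Function.update (fun _ => 0) 7 (j : ℕ)) 0 i)).toStacks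
      (Query.rule.time.eval n + (1 + (12 * n + 6) + 1)) false
      (Memory.ready G (greedyStep G S i)
        (Function.update (Function.update (fun _ => 0) 7 (j : ℕ)) 0 i)).toStacks := by
  classical
  have hn : 0 < n := i.pos
  -- The register contents are read as an assignment of vertices; the unused registers denote vertex
  -- `0`, which exists because of `i`.
  let e : Fin 8 → Fin n := Function.update (Function.update (fun _ => ⟨0, hn⟩) 7 j) 0 i
  have he : Function.update (Function.update (fun _ => 0) 7 (j : ℕ)) 0 (i : ℕ) =
      fun x => (e x : ℕ) := by
    funext x
    by_cases h0 : x = 0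
    · subst h0; simp [e]
    · by_cases h7 : x = 7
      · subst h7; simp [e]
      · simp [e, h0, h7]
  have h1 := Query.rule.does_program G S e false Query.wellScoped_rule fun x hx => by
    simp [e, Query.bound_rule hx]
  rw [he]
  refine h1.seq (Does.seq (f₂ := decide (Query.rule.Holds G S e)) ?_ (does_setFlag _ false _))
  rw [greedyStep, dif_pos i.2]
  by_cases h : RuleApplies (isolate G S) i
  · rw [decide_eq_true (Query.holds_rule.2 (by simpa [e] using h)), if_pos h]
    convert does_ifFlag_true (does_store (f := true) G S (x := 0) (l := fun x => (e x : ℕ)) (i := i)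
      (by simp [e]))
  · rw [decide_eq_false (Query.holds_rule.not.2 (by simpa [e] using h)), if_neg h]
    exact does_ifFlag_false ((does_setFlag false false _).mono (by omega))

/-- The program that computes a minimum deletion set. -/
noncomputable def main : Program 8 :=
  -- The outer loop only counts `n` passes. Clearing the stacks and reloading the initial control
  -- state produce the required halting configuration.
  (setUp.seq ((forAll 7 (forAll 0 step)).seq
    (clearAll (Finset.univ.erase (arr true)).toList))).seq (.load fun _ => ⟨false, false, none⟩)

/-- A bound for the running time of `main`. -/
noncomputable def mainTime : Polynomial ℕ :=
  -- The constant `21` is `r + 13` in `does_setUp` with `r = 8` registers.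
  .X * (.X + 1) * 21 + 5 +
    ((.X * ((.X * ((Query.rule.time + (1 + (12 * .X + 6) + 1)) + 8) + 4) + 8) + 4) +
      (.C ((Finset.univ.erase (arr (r := 8) true)).toList.length) *
        ((.X * (.X + 1)) * 3 + 2) + 1 + 1))

theorem runs_main (G : SimpleGraph (Fin n)) :
    main.Runs (⟨false, false, none⟩, Function.update (fun _ => []) inp (encodeGraph G))
      (mainTime.eval n)
      (⟨false, false, none⟩,
        Function.update (fun _ => []) (arr true) (encodeSet (greedySet G n))) := by
  have hS : Function.update (β := fun k : Stack 8 => List k.Alphabet)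
      (fun _ => []) inp (encodeGraph G) =
      (readMemory 8 n 0 (encodeGraph G)).toStacks := by
    funext k
    by_cases hk : k = inp
    · subst hk; simp [Memory.toStacks, readMemory]
    · rw [Function.update_of_ne hk]
      cases k <;> simp_all [Memory.toStacks, readMemory]
  have hS' : Function.update (β := fun k : Stack 8 => List k.Alphabet)
      (fun _ => []) (arr true) (encodeSet (greedySet G n)) =
      fun k => if k ∈ (Finset.univ.erase (arr (r := 8) true)).toList then [] else
        (Memory.ready G (greedySet G n) fun _ => 0).toStacks k := by
    funext k
    by_cases hk : k = arr true
    · subst hk; simp [Memory.toStacks, Memory.ready]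
    · simp [hk]
  have h1 := does_setUp (r := 8) G false
  have h2 := does_forAll (f := false) (x := (7 : Fin 8)) (p := forAll 0 step)
    (l := fun _ => 0) G rfl
    (greedySet G) fun j hj => does_forAll (f := false) (x := (0 : Fin 8)) (p := step)
      (l := Function.update (fun _ => 0) 7 j) G (by simp) (greedyPass G (greedySet G j))
      fun i hi => does_step G _ ⟨i, hi⟩ ⟨j, hj⟩
  -- No stack is longer than the input word at this point.
  have h3 := does_clearAll (N := n * (n + 1)) (Finset.univ.erase (arr (r := 8) true)).toList
    (Memory.ready G (greedySet G n) fun _ => 0).toStacks false fun k => by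
      have : n ≤ n * (n + 1) := Nat.le_mul_of_pos_right n (Nat.succ_pos n)
      cases k <;> simp [Memory.toStacks, Memory.ready, length_encodeGraph, length_encodeSet, this]
  rw [hS, hS']
  obtain ⟨v, -, hr⟩ := h1.seq (h2.seq h3) ⟨false, false, none⟩ rfl
  refine (hr.seq (runs_load _ _ _)).mono (le_of_eq ?_)
  simp [mainTime]
  ring

end Program

/-! ### Polynomial time in the length of the input word -/

theorem eval_le_eval_of_le (p : Polynomial ℕ) {m n : ℕ} (h : m ≤ n) : p.eval m ≤ p.eval n := by
  rw [Polynomial.eval_eq_sum_range, Polynomial.eval_eq_sum_range]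
  exact Finset.sum_le_sum fun i _ => Nat.mul_le_mul_left _ (Nat.pow_le_pow_left h i)

/-- The machine that computes a minimum deletion set. -/
noncomputable def deletionMachine : Turing.FinTM2 :=
  machine (Γ := Stack.Alphabet (r := 8)) .inp (.arr true) (⟨false, false, none⟩ : Control)
    Program.main

/-- The time bound in `n` is also one in the word length `n * (n + 1)`, by monotonicity. The words
are given up to equations because the final statement presents them mapped through identity
equivalences of the alphabets. -/
theorem outputs_deletionMachine {n : ℕ} (G : SimpleGraph (Fin n)) {x : List (Option Bool)}
    {y : List Bool} (hx : x = encodeGraph G) (hy : y = encodeSet (greedySet G n)) :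
    Nonempty (Turing.TM2OutputsInTime deletionMachine x (some y)
      ((Program.mainTime + 1).eval (encodeGraph G).length)) := by
  subst hx hy
  obtain ⟨h⟩ := (Program.runs_main G).outputs
  refine ⟨h.toEvalsTo, h.steps_le_m.trans ?_⟩
  rw [Polynomial.eval_add, Polynomial.eval_one, length_encodeGraph]
  exact Nat.succ_le_succ
    (eval_le_eval_of_le _ (Nat.le_mul_of_pos_right n (Nat.succ_pos n)))

end VertexDeletion

theorem mainTheorem6 : VertexDeletion.InP VertexDeletion.block VertexDeletion.cluster := by
  refine ⟨fun I => VertexDeletion.greedySet I.graph I.order,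
    fun I => VertexDeletion.isMinimumDeletionSet_greedySet I.mem, ⟨?_⟩⟩
  exact
    { tm := VertexDeletion.deletionMachine
      inputAlphabet := Equiv.refl (Option Bool)
      outputAlphabet := Equiv.refl Bool
      time := VertexDeletion.Program.mainTime + 1
      outputsFun := fun I =>
        (VertexDeletion.outputs_deletionMachine I.graph (List.map_id _) (List.map_id _)).some }
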